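/- **Conventions.** Points of $\mathbb R^{n+m}$ are written $(x,y)$, $x\in\mathbb R^n$, $y\in\mathbb R^m$; for $K\subseteq\mathbb R^{n+m}$ put $\pi_Y(K)=\{y: \exists x,\ (x,y)\in K\}$ and $K_y=\{x:(x,y)\in K\}$. All function spaces are real. *Partially convex sets.* $K$ is partially convex if every $K_y$ is convex, and *regular partially convex* if moreover $K$ is closed, $\operatorname{int}K_y\neq\emptyset$ for all $y\in\pi_Y(K)$, and $y\mapsto \operatorname{int}K_y$ is lower hemicontinuous on $\pi_Y(K)$ (for all $y_k\to y$ in $\pi_Y(K)$ and $x\in \operatorname{int}K_y$ there are $x_k\in\operatorname{int} K_{y_k}$ with $x_k\to x$). $\mathcal C_{\mathrm{aff}}(K)$ is the space of continuous $f:K\to\mathbb R$ such that each $f(\cdot,y)$ is affine on $K_y$, with the pointwise order and unit $1$. The same notions are used for sets of pairs $(x,y)$ with $x$ in any real topological vector space. An *isomorphism* $K\to L$ is a homeomorphism $\Theta(x,y)=(\theta_y(x),\phi(y))$ with $\phi:\pi_Y(K)\to\pi_Y(L)$ a homeomorphism and every $\theta_y:K_y\to L_{\phi(y)}$ an affine homeomorphism.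 *Free order unit modules.* A free order unit module of type $(n,m)$ is a real Archimedean order unit (AOU) space $(A,A^+,u)$, with order unit norm $\|\cdot\|$, together with a unital linear order embedding of $A$ into $C(X)$, $X$ compact Hausdorff, through which products of elements of $A$ are formed, a compact set $Y\subseteq\mathbb R^m$, and an algebra isomorphism of $C(Y)$ onto the multiplicative domain $\mathcal M_A=\{z\in A: za\in A\ \forall a\in A\}$ (so $C(Y)$ acts on $A$), such that: - there are $e_0=u,e_1,\dots,e_n\in A$ such that every $a\in A$ is uniquely $a=\sum_{i=0}^n c_ie_i$ with $c_i\in C(Y)$; - for $y\in Y$ let $J_y$ be the smallest norm closed order ideal of $A$ (a subspace $J$ with $0\le p\le q\in J\Rightarrow p\in J$) containing $\{f\in C(Y)\cong\mathcal M_A: f(y)=0\}$, let $A_y=A/J_y$, let $[a]_y$ be the class of $a$, and let $A_y^+$ be the image of $A^+$; then $(A_y,A_y^+,[u]_y)$ is an AOU space of dimension $n+1$, with norm $\|\cdot\|_y$, and $a\in A^+$ if and only if $[a]_y\in A_y^+$ for all $y\in Y$; - for $y_k\to y_0$ in $Y$, say that $a_k\in A_{y_k}$ converge to $a_0\in A_{y_0}$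 if some $a\in A$ has $[a]_{y_0}=a_0$ and $\|a_k-[a]_{y_k}\|_{y_k}\to0$. Then $y\mapsto A_y^+$ is lower hemicontinuous (whenever $y_k\to y_0$ in $Y$, every element of $A_{y_0}^+$ is a limit of some $a_k\in A_{y_k}^+$), and for each $r>0$ the map $y\mapsto A_y^+\cap\{\|\cdot\|_y\le r\}$ is upper hemicontinuous (whenever $y_k\to y_0$ in $Y$, every sequence $a_k\in A_{y_k}^+$ with $\|a_k\|_{y_k}\le r$ has a subsequence converging to some $a_0\in A_{y_0}^+$ with $\|a_0\|_{y_0}\le r$); - the coefficient map $a\mapsto(c_0,\dots,c_n)$ is a homeomorphism from $(A,\|\cdot\|)$ onto $C(Y)^{n+1}$ with the sup norm. *State spaces.* For $y\in Y$, a $y$-state is a positive linear $\Phi:A\to\mathbb R$ with $\Phi(u)=1$ and $\Phi(g\cdot a)=g(y)\Phi(a)$ for $g\in C(Y)$, $a\in A$. The partially convex state space is $S_{\mathrm{par}}(A)=\{(\Phi,y): y\in Y,\ \Phi\text{ a }y\text{-state}\}$, with the topology of pointwise convergence on $A$ in $\Phi$ and the Euclidean topology in $y$. The coordinate state space is $K_A=\{(\Phi(e_1),\dots,\Phi(e_n),y):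 y\in Y,\ \Phi\text{ a }y\text{-state}\}\subseteq\mathbb R^{n+m}$. **Theorem.** Let $n,m\ge 0$. 1. Let $K\subseteq\mathbb R^{n+m}$ be a compact regular partially convex set. Then there is a free order unit module $A$ of type $(n,m)$ such that $S_{\mathrm{par}}(A)$ is partially convex and $K$ is isomorphic to $S_{\mathrm{par}}(A)$, and also to $K_A$. One can take $A=\mathcal C_{\mathrm{aff}}(K)$ with the pointwise order, unit $1$, $X=K$, the inclusion into $C(K)$, $Y=\pi_Y(K)$, and $g\in C(Y)$ regarded as the function $(x,y)\mapsto g(y)$. 2. Let $A$ be a free order unit module of type $(n,m)$. Then there is a compact regular partially convex set $K\subseteq\mathbb R^{n+m}$, namely $K=K_A$, with $\pi_Y(K)=Y$, and a unital linear order isomorphism $F:A\to\mathcal C_{\mathrm{aff}}(K)$ satisfying $F(g\cdot a)(x,y)=g(y)\,F(a)(x,y)$ for all $g\in C(Y)$, $a\in A$, $(x,y)\in K$. -/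

import Mathlib

open Filter Topology

universe u v

namespace PartialDuality

/-! ### Partially convex sets -/

section PartiallyConvexSets

variable {V W V' W' : Type*}

/-- The projection `π_Y(K)` of a set of pairs `(x, y)` to the `y`-coordinate. -/
def projY (K : Set (V × W)) : Set W := {y | ∃ x, (x, y) ∈ K}

/-- The slice `K_y = {x | (x, y) ∈ K}`. -/
def slice (K : Set (V × W)) (y : W) : Set V := {x | (x, y) ∈ K}

/-- `K` is partially convex in `x`: every slice over the projection is convex. -/
def PartiallyConvex [AddCommGroup V] [Module ℝ V] (K : Set (V × W)) : Prop :=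
  ∀ y ∈ projY K, Convex ℝ (slice K y)

/-- Lower hemicontinuity on `Y` of the set-valued map `y ↦ Φ y`, in its sequential form. -/
def LowerHemicontinuousSeqOn [TopologicalSpace V] [TopologicalSpace W]
    (Φ : W → Set V) (Y : Set W) : Prop :=
  ∀ y ∈ Y, ∀ ys : ℕ → W, (∀ k, ys k ∈ Y) → Tendsto ys atTop (𝓝 y) →
    ∀ x ∈ Φ y, ∃ xs : ℕ → V, (∀ k, xs k ∈ Φ (ys k)) ∧ Tendsto xs atTop (𝓝 x)

/-- Regular partially convex sets. -/
structure IsRegularPartiallyConvex [AddCommGroup V] [Module ℝ V] [TopologicalSpace V]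
    [TopologicalSpace W] (K : Set (V × W)) : Prop where
  isClosed : IsClosed K
  partiallyConvex : PartiallyConvex K
  interior_nonempty : ∀ y ∈ projY K, (interior (slice K y)).Nonempty
  lhc : LowerHemicontinuousSeqOn (fun y => interior (slice K y)) (projY K)

/-- A map between subsets of real vector spaces is affine if it preserves those convex
combinations of two points that lie in its domain. -/
def IsAffineMap [AddCommGroup V] [Module ℝ V] [AddCommGroup V'] [Module ℝ V']
    {S : Set V} (f : S → V') : Prop :=
  ∀ (x₁ x₂ x₃ : S) (s t : ℝ), 0 ≤ s → 0 ≤ t → s + t = 1 →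
    (x₃ : V) = s • (x₁ : V) + t • (x₂ : V) → f x₃ = s • f x₁ + t • f x₂

/-- Two partially convex sets are isomorphic: there is a homeomorphism `Θ : K → L` of the form
`Θ (x, y) = (θ_y x, φ y)`, where `φ` is a homeomorphism of the projections and every
`θ_y : K_y → L_{φ y}` is an affine homeomorphism. -/
def PartiallyConvexIso [AddCommGroup V] [Module ℝ V] [TopologicalSpace V] [TopologicalSpace W]
    [AddCommGroup V'] [Module ℝ V'] [TopologicalSpace V'] [TopologicalSpace W']
    (K : Set (V × W)) (L : Set (V' × W')) : Prop :=
  ∃ (Θ : K ≃ₜ L) (φ : projY K ≃ₜ projY L)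
    (θ : ∀ y : projY K, slice K (y : W) ≃ₜ slice L (φ y : W')),
    (∀ (x : V) (y : W) (h : (x, y) ∈ K),
      (Θ ⟨(x, y), h⟩ : V' × W') = ((θ ⟨y, x, h⟩ ⟨x, h⟩ : V'), (φ ⟨y, x, h⟩ : W'))) ∧
    ∀ y : projY K, IsAffineMap (fun x => (θ y x : V'))

/-- The space of continuous partially affine functions on `K`: the continuous functions
`f : K → ℝ` such that `x ↦ f (x, y)` is affine on `K_y` for every fixed `y`. -/
def Caff [AddCommGroup V] [Module ℝ V] [TopologicalSpace V] [TopologicalSpace W]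
    (K : Set (V × W)) : Submodule ℝ C(K, ℝ) where
  carrier := {f | ∀ y : W, IsAffineMap (S := slice K y) (fun x => f ⟨((x : V), y), x.2⟩)}
  add_mem' := by
    intro f g hf hg y x₁ x₂ x₃ s t hs ht hst hx
    have h₁ := hf y x₁ x₂ x₃ s t hs ht hst hx
    have h₂ := hg y x₁ x₂ x₃ s t hs ht hst hx
    simp only [smul_eq_mul, ContinuousMap.add_apply] at h₁ h₂ ⊢
    rw [h₁, h₂]; ring
  zero_mem' := by
    intro y x₁ x₂ x₃ s t hs ht hst hx
    simp
  smul_mem' := by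
    intro c f hf y x₁ x₂ x₃ s t hs ht hst hx
    have h₁ := hf y x₁ x₂ x₃ s t hs ht hst hx
    simp only [smul_eq_mul, ContinuousMap.smul_apply] at h₁ ⊢
    rw [h₁]; ring

end PartiallyConvexSets

/-! ### Archimedean order unit spaces -/

section OrderUnitSpaces

variable {V : Type*} [AddCommGroup V] [Module ℝ V]

/-- A real vector space with positive cone `C` is an Archimedean order unit space with
order unit `e`. -/
structure IsAOUSpace (C : PointedCone ℝ V) (e : V) : Prop where
  salient : ∀ v, v ∈ C → -v ∈ C → v = 0
  order_unit : ∀ v, ∃ r : ℝ, 0 < r ∧ r • e - v ∈ C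
  archimedean : ∀ v, (∀ r : ℝ, 0 < r → r • e + v ∈ C) → v ∈ C

/-- The order unit norm `‖v‖ = inf {r > 0 | - r e ≤ v ≤ r e}`. -/
noncomputable def orderNorm (C : PointedCone ℝ V) (e v : V) : ℝ :=
  sInf {r : ℝ | 0 < r ∧ r • e - v ∈ C ∧ r • e + v ∈ C}

/-- Order ideals: subspaces `J` such that `0 ≤ p ≤ q` and `q ∈ J` imply `p ∈ J`. -/
def IsOrderIdeal (C : PointedCone ℝ V) (J : Submodule ℝ V) : Prop :=
  ∀ p q : V, p ∈ C → q - p ∈ C → q ∈ J → p ∈ J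

/-- Subspaces that are closed in the order unit norm. -/
def IsOrderNormClosed (C : PointedCone ℝ V) (e : V) (J : Submodule ℝ V) : Prop :=
  ∀ a : V, (∀ ε : ℝ, 0 < ε → ∃ b ∈ J, orderNorm C e (a - b) < ε) → a ∈ J

/-- The closed order ideal generated by a set: the smallest norm closed order ideal
containing it. -/
def closedOrderIdealSpan (C : PointedCone ℝ V) (e : V) (s : Set V) : Submodule ℝ V :=
  sInf {J | IsOrderIdeal C J ∧ IsOrderNormClosed C e J ∧ s ⊆ J}

end OrderUnitSpaces

/-- The multiplicative domain `{z ∈ A | ∀ a ∈ A, z · a ∈ A}` of a space `A` that is embedded by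
`j` into the algebra `C(X)`; the product is the one of `C(X)`. -/
def multiplicativeDomain {A X : Type*} [AddCommGroup A] [Module ℝ A] [TopologicalSpace X]
    (j : A →ₗ[ℝ] C(X, ℝ)) : Set A :=
  {z | ∀ a : A, ∃ b : A, j b = j z * j a}

/-! ### Free order unit modules -/

/-- The order and multiplication part of a free order unit module: an Archimedean order unit
space `A`, embedded as an ordered space with unit into a commutative algebra `C(X)`, whose
multiplicative domain `M_A` is identified by an isomorphism of algebras with `C(Y)` for a compact
set `Y ⊆ ℝ^m`. -/
structure OrderUnitModule (m : ℕ) (A : Type u) (X : Type v) [AddCommGroup A] [Module ℝ A]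
    [TopologicalSpace X] where
  /-- the positive cone `A⁺` -/
  pos : PointedCone ℝ A
  /-- the order unit `u` -/
  unit : A
  isAOUSpace : IsAOUSpace pos unit
  compactSpace : CompactSpace X
  t2Space : T2Space X
  /-- the embedding of `A` into `C(X)` -/
  emb : A →ₗ[ℝ] C(X, ℝ)
  emb_unit : emb unit = 1
  mem_pos_iff_emb : ∀ a, a ∈ pos ↔ ∀ t, 0 ≤ emb a t
  /-- the base space -/
  Y : Set (EuclideanSpace ℝ (Fin m))
  isCompact_Y : IsCompact Y
  /-- the identification of `C(Y)` with `M_A ⊆ A` -/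
  incl : C(Y, ℝ) →ₗ[ℝ] A
  incl_injective : Function.Injective incl
  range_incl : Set.range incl = multiplicativeDomain emb
  incl_one : incl 1 = unit
  incl_mul : ∀ f g : C(Y, ℝ), emb (incl (f * g)) = emb (incl f) * emb (incl g)

namespace OrderUnitModule

variable {m : ℕ} {A : Type u} {X : Type v} [AddCommGroup A] [Module ℝ A] [TopologicalSpace X]
  (D : OrderUnitModule m A X)

theorem exists_act (g : C(D.Y, ℝ)) (a : A) : ∃ b : A, D.emb b = D.emb (D.incl g) * D.emb a := by
  have h : D.incl g ∈ multiplicativeDomain D.emb := by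
    rw [← D.range_incl]; exact ⟨g, rfl⟩
  exact h a

/-- The action `g · a` of `g ∈ C(Y) ≅ M_A` on `a ∈ A`: the element of `A` which is the product
in `C(X)` of the elements `g` of `M_A` and `a` of `A`. -/
noncomputable def act (g : C(D.Y, ℝ)) (a : A) : A := Classical.choose (D.exists_act g a)

theorem emb_act (g : C(D.Y, ℝ)) (a : A) : D.emb (D.act g a) = D.emb (D.incl g) * D.emb a :=
  Classical.choose_spec (D.exists_act g a)

/-- The embedding is injective, so `act` is the only operation satisfying `emb_act`. -/
theorem emb_injective : Function.Injective D.emb := by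
  rw [injective_iff_map_eq_zero]
  intro a ha
  refine D.isAOUSpace.salient a ?_ ?_
  · rw [D.mem_pos_iff_emb]; simp [ha]
  · rw [D.mem_pos_iff_emb]; simp [ha]

/-- The closed order ideal `J_y` of `A` generated by `I_y = {f ∈ C(Y) | f y = 0}`. -/
def fiberIdeal (y : D.Y) : Submodule ℝ A :=
  closedOrderIdealSpan D.pos D.unit {a | ∃ f : C(D.Y, ℝ), f y = 0 ∧ D.incl f = a}

/-- The fiber `A_y = A / J_y`. -/
abbrev Fiber (y : D.Y) : Type u := A ⧸ D.fiberIdeal y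

/-- The class `[a]_y` of `a` in the fiber. -/
def toFiber (y : D.Y) : A →ₗ[ℝ] D.Fiber y := (D.fiberIdeal y).mkQ

/-- The quotient cone `(A_y)⁺`, the image of `A⁺`. -/
noncomputable def fiberPos (y : D.Y) : PointedCone ℝ (D.Fiber y) := D.pos.map (D.toFiber y)

/-- The norm of the fiber `A_y`, the order unit norm for `[u]_y`. -/
noncomputable def fiberNorm (y : D.Y) (a : D.Fiber y) : ℝ :=
  orderNorm (D.fiberPos y) (D.toFiber y D.unit) a

/-- Convergence of elements `a_k` of the fibers over `y_k` to an element `a₀` of the fiber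
over `y₀`. -/
def FiberTendsto (ys : ℕ → D.Y) (as : ∀ k, D.Fiber (ys k)) (y₀ : D.Y) (a₀ : D.Fiber y₀) : Prop :=
  Tendsto ys atTop (𝓝 y₀) ∧ ∃ a : A, D.toFiber y₀ a = a₀ ∧
    Tendsto (fun k => D.fiberNorm (ys k) (as k - D.toFiber (ys k) a)) atTop (𝓝 0)

/-- A `y`-state: a positive unital linear functional with `Φ (g · a) = g y * Φ a`. -/
structure IsFiberState (y : D.Y) (Φ : A →ₗ[ℝ] ℝ) : Prop where
  nonneg : ∀ a ∈ D.pos, 0 ≤ Φ a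
  map_unit : Φ D.unit = 1
  map_act : ∀ (g : C(D.Y, ℝ)) (a : A), Φ (D.act g a) = g y * Φ a

/-- The partially convex state space `S_par(A) = ⋃ S_y(A) × {y}`. Functionals are regarded as
points of `A → ℝ`, with the topology of pointwise convergence on `A`. -/
def stateSpace : Set ((A → ℝ) × EuclideanSpace ℝ (Fin m)) :=
  {p | ∃ (hy : p.2 ∈ D.Y) (Φ : A →ₗ[ℝ] ℝ), D.IsFiberState ⟨p.2, hy⟩ Φ ∧ p.1 = Φ}

end OrderUnitModule

/-- Free order unit modules of type `(n, m)`. -/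
structure FreeOrderUnitModule (n m : ℕ) (A : Type u) (X : Type v) [AddCommGroup A] [Module ℝ A]
    [TopologicalSpace X] extends OrderUnitModule m A X where
  /-- the basis `e_0, …, e_n` of `A` over `M_A ≅ C(Y)` -/
  basis : Fin (n + 1) → A
  existsUnique_coeff : ∀ a : A, ∃! c : Fin (n + 1) → C(Y, ℝ),
    a = ∑ i, toOrderUnitModule.act (c i) (basis i)
  unit_eq : unit = toOrderUnitModule.act 1 (basis 0)
  fiber_isAOUSpace : ∀ y : Y,
    IsAOUSpace (toOrderUnitModule.fiberPos y) (toOrderUnitModule.toFiber y unit)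
  fiber_finrank : ∀ y : Y, Module.finrank ℝ (toOrderUnitModule.Fiber y) = n + 1
  mem_pos_iff_fiber : ∀ a : A, a ∈ pos ↔
    ∀ y : Y, toOrderUnitModule.toFiber y a ∈ toOrderUnitModule.fiberPos y
  /-- lower hemicontinuity of `y ↦ (A_y)⁺` -/
  pos_lhc : ∀ (y₀ : Y) (ys : ℕ → Y), Tendsto ys atTop (𝓝 y₀) →
    ∀ a₀ ∈ toOrderUnitModule.fiberPos y₀,
      ∃ as : ∀ k, toOrderUnitModule.Fiber (ys k),
        (∀ k, as k ∈ toOrderUnitModule.fiberPos (ys k)) ∧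
        toOrderUnitModule.FiberTendsto ys as y₀ a₀
  /-- upper hemicontinuity of `y ↦ (A_y)⁺ ∩ {‖a‖ ≤ r}` for every `r > 0` -/
  pos_uhc : ∀ r : ℝ, 0 < r → ∀ (y₀ : Y) (ys : ℕ → Y), Tendsto ys atTop (𝓝 y₀) →
    ∀ as : ∀ k, toOrderUnitModule.Fiber (ys k),
      (∀ k, as k ∈ toOrderUnitModule.fiberPos (ys k) ∧
        toOrderUnitModule.fiberNorm (ys k) (as k) ≤ r) →
      ∃ (κ : ℕ → ℕ) (a₀ : toOrderUnitModule.Fiber y₀), StrictMono κ ∧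
        a₀ ∈ toOrderUnitModule.fiberPos y₀ ∧ toOrderUnitModule.fiberNorm y₀ a₀ ≤ r ∧
        toOrderUnitModule.FiberTendsto (fun k => ys (κ k)) (fun k => as (κ k)) y₀ a₀
  /-- the coefficient map `A → C(Y)^(n+1)` is a homeomorphism -/
  tendsto_iff_coeff : ∀ (cs : ℕ → Fin (n + 1) → C(Y, ℝ)) (c : Fin (n + 1) → C(Y, ℝ)),
    Tendsto (fun k => orderNorm pos unit
        (∑ i, toOrderUnitModule.act (cs k i) (basis i) -
          ∑ i, toOrderUnitModule.act (c i) (basis i))) atTop (𝓝 0) ↔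
      ∀ i, Tendsto (fun k => ⨆ y : Y, |cs k i y - c i y|) atTop (𝓝 0)

/-- The partially convex coordinate state space
`K_A = {((Φ e_1, …, Φ e_n), y) | y ∈ Y, Φ a y-state} ⊆ ℝ^n × ℝ^m`. -/
def FreeOrderUnitModule.coordStateSpace {n m : ℕ} {A : Type u} {X : Type v} [AddCommGroup A]
    [Module ℝ A] [TopologicalSpace X] (M : FreeOrderUnitModule n m A X) :
    Set (EuclideanSpace ℝ (Fin n) × EuclideanSpace ℝ (Fin m)) :=
  {p | ∃ (hy : p.2 ∈ M.Y) (Φ : A →ₗ[ℝ] ℝ), M.IsFiberState ⟨p.2, hy⟩ Φ ∧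
    ∀ i : Fin n, p.1 i = Φ (M.basis i.succ)}

end PartialDuality

open PartialDuality

/-! An affine function on a convex body in `ℝ^n` with nonempty interior is `x ↦ c_0 + ∑ c_i x_i` for
a unique `c ∈ ℝ^(n+1)`. Hence a partially affine function on `K` is a family of coefficient vectors
over `Y`, and the theorem comes down to continuity of this family and to duality in each fiber.

From sets to modules: compactness and lower hemicontinuity bound the coefficients by the values on a
slice, uniformly over the base (`exists_coeff_bound`). This makes the coefficients continuous
(`exists_continuous_coeff`), so `Caff K` is free over `C(Y)` on `1, x_1, …, x_n`. Its fiber at `y`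
is the space of affine functions on `K_y`, with the pointwise order: a function nonnegative over `y`
becomes nonnegative everywhere after adding a base function that vanishes at `y`
(`exists_base_correction`). Hyperplane separation then shows that the `y`-states are the evaluations
at points of `K_y`, so the coordinate state space is `K` itself.

From modules to sets: freeness and the dimension of the fibers identify `A_y` with `ℝ^(n+1)`, and
`[u]_y` with the first unit vector. The bipolar theorem (`IsAOUSpace.mem_iff_coneStates`) turns the
fiber cone into the affine functions nonnegative on the slice of `K_A`; this slice has interior
points because the cone is salient. Suppose an interior point over `y₀` fails to be interior over
infinitely many `y_k → y₀`. Normalized supporting functions there have, by upper hemicontinuity of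
the cones, a limit of norm one that is nonnegative on the slice over `y₀` and vanishes at an
interior point, which is absurd (`eventually_mem_interior_slice`). Reading off coefficient limits
needs control that is uniform over the base, provided by `exists_fiber_coeff_bound`. So `K_A` is
regular, and continuity of coefficients, applied to `K_A`, gives surjectivity of the representation.
-/

namespace PartialDuality

/-! ### Affine functions on `ℝ^n` in coordinates -/

section AffEval

variable {n : ℕ}

/-- The affine function `x ↦ c_0 + ∑ c_i x_i` with coefficients `c`. -/
def affEval (c : Fin (n + 1) → ℝ) (x : EuclideanSpace ℝ (Fin n)) : ℝ :=
  c 0 + ∑ i : Fin n, c i.succ * x i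

theorem affEval_add (c d : Fin (n + 1) → ℝ) (x : EuclideanSpace ℝ (Fin n)) :
    affEval (c + d) x = affEval c x + affEval d x := by
  simp only [affEval, Pi.add_apply, add_mul, Finset.sum_add_distrib]; ring

theorem affEval_smul (r : ℝ) (c : Fin (n + 1) → ℝ) (x : EuclideanSpace ℝ (Fin n)) :
    affEval (r • c) x = r * affEval c x := by
  simp only [affEval, Pi.smul_apply, smul_eq_mul, mul_add, Finset.mul_sum, mul_assoc]

theorem affEval_sub (c d : Fin (n + 1) → ℝ) (x : EuclideanSpace ℝ (Fin n)) :
    affEval (c - d) x = affEval c x - affEval d x := by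
  simp only [affEval, Pi.sub_apply, sub_mul, Finset.sum_sub_distrib]; ring

theorem affEval_neg (c : Fin (n + 1) → ℝ) (x : EuclideanSpace ℝ (Fin n)) :
    affEval (-c) x = -affEval c x := by
  simp only [affEval, Pi.neg_apply, neg_mul, Finset.sum_neg_distrib]; ring

@[simp] theorem affEval_zero (x : EuclideanSpace ℝ (Fin n)) :
    affEval (0 : Fin (n + 1) → ℝ) x = 0 := by simp [affEval]

@[simp] theorem affEval_single_zero (x : EuclideanSpace ℝ (Fin n)) (r : ℝ) :
    affEval (Pi.single 0 r) x = r := by simp [affEval]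

@[simp] theorem affEval_single_succ (x : EuclideanSpace ℝ (Fin n)) (i : Fin n) (r : ℝ) :
    affEval (Pi.single i.succ r) x = r * x i := by
  simp [affEval, Pi.single_apply]

theorem affEval_combo (c : Fin (n + 1) → ℝ) (x₁ x₂ : EuclideanSpace ℝ (Fin n)) {s t : ℝ}
    (hst : s + t = 1) :
    affEval c (s • x₁ + t • x₂) = s * affEval c x₁ + t * affEval c x₂ := by
  simp only [affEval, PiLp.add_apply, PiLp.smul_apply, smul_eq_mul, mul_add,
    Finset.sum_add_distrib, Finset.mul_sum]
  have h : c 0 = s * c 0 + t * c 0 := by rw [← add_mul, hst, one_mul]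
  have h₁ : ∀ i : Fin n, c i.succ * (s * x₁ i) = s * (c i.succ * x₁ i) := fun i => by ring
  have h₂ : ∀ i : Fin n, c i.succ * (t * x₂ i) = t * (c i.succ * x₂ i) := fun i => by ring
  simp only [h₁, h₂]
  linarith

theorem continuous_affEval :
    Continuous fun p : (Fin (n + 1) → ℝ) × EuclideanSpace ℝ (Fin n) => affEval p.1 p.2 := by
  unfold affEval; fun_prop

theorem continuous_affEval_right (c : Fin (n + 1) → ℝ) : Continuous (affEval c) :=
  continuous_affEval.comp (Continuous.prodMk_right c)

theorem abs_affEval_le (c : Fin (n + 1) → ℝ) (x : EuclideanSpace ℝ (Fin n)) :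
    |affEval c x| ≤ ‖c‖ * (1 + ∑ i, |x i|) := by
  rw [affEval, mul_add, mul_one, Finset.mul_sum]
  refine (abs_add_le _ _).trans (add_le_add (norm_le_pi_norm c 0) ?_)
  refine (Finset.abs_sum_le_sum_abs _ _).trans (Finset.sum_le_sum fun i _ => ?_)
  rw [abs_mul]
  exact mul_le_mul_of_nonneg_right (norm_le_pi_norm c _) (abs_nonneg _)

/-- Every affine function on `ℝ^n` has coefficients. -/
theorem exists_affEval_eq (b : ℝ) (f : EuclideanSpace ℝ (Fin n) →ₗ[ℝ] ℝ) :
    ∃ c : Fin (n + 1) → ℝ, ∀ x, affEval c x = b + f x := by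
  refine ⟨Fin.cons b fun i => f (EuclideanSpace.single i 1), fun x => ?_⟩
  have hx : x = ∑ i, x i • EuclideanSpace.single i (1 : ℝ) := by
    ext j
    simp [Finset.sum_apply, Pi.single_apply]
  conv_rhs => rw [hx]
  simp [affEval, map_sum, mul_comm]

theorem affEval_add_smul_single (c : Fin (n + 1) → ℝ) (x : EuclideanSpace ℝ (Fin n)) (i : Fin n)
    (t : ℝ) : affEval c (x + t • EuclideanSpace.single i (1 : ℝ)) = affEval c x + t * c i.succ := by
  simp only [affEval, PiLp.add_apply, PiLp.smul_apply, smul_eq_mul, mul_add,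
    Finset.sum_add_distrib]
  simp; ring

theorem affEval_eq_sum (c : Fin (n + 1) → ℝ) (x : EuclideanSpace ℝ (Fin n)) :
    affEval c x = ∑ i, c i * affEval (Pi.single i 1) x := by
  simp only [Fin.sum_univ_succ, affEval_single_zero, affEval_single_succ, mul_one, one_mul]
  rfl

/-- From an interior point one can move a little in both directions along a vector. -/
theorem exists_pos_smul_mem_of_mem_interior {S : Set (EuclideanSpace ℝ (Fin n))}
    {x : EuclideanSpace ℝ (Fin n)} (hx : x ∈ interior S) (v : EuclideanSpace ℝ (Fin n)) :
    ∃ t : ℝ, 0 < t ∧ x + t • v ∈ S ∧ x + (-t) • v ∈ S := by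
  have hcont : Continuous fun t : ℝ => x + t • v := by fun_prop
  have hev : ∀ᶠ t in 𝓝 (0 : ℝ), x + t • v ∈ S := by
    have := hcont.tendsto 0
    simp only [zero_smul, add_zero] at this
    exact this (mem_interior_iff_mem_nhds.1 hx)
  obtain ⟨ε, hε, hball⟩ := Metric.eventually_nhds_iff.1 hev
  exact ⟨ε / 2, by positivity, hball (by simp [abs_of_pos hε, hε]),
    hball (by simp [abs_of_pos hε, hε])⟩

/-- An affine function which is nonnegative near `x` and vanishes at `x` is zero. -/
theorem eq_zero_of_nonneg_of_mem_interior {c : Fin (n + 1) → ℝ}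
    {S : Set (EuclideanSpace ℝ (Fin n))} {x : EuclideanSpace ℝ (Fin n)} (hx : x ∈ interior S)
    (hS : ∀ z ∈ S, 0 ≤ affEval c z) (h0 : affEval c x ≤ 0) : c = 0 := by
  have key : ∀ i : Fin n, c i.succ = 0 := by
    intro i
    obtain ⟨t, ht, h₁, h₂⟩ :=
      exists_pos_smul_mem_of_mem_interior hx (EuclideanSpace.single i (1 : ℝ))
    replace h₁ := hS _ h₁
    replace h₂ := hS _ h₂
    rw [affEval_add_smul_single] at h₁ h₂
    nlinarith
  have hx0 : c 0 = 0 := by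
    have h₁ := hS x (interior_subset hx)
    simp only [affEval, key, zero_mul, Finset.sum_const_zero, add_zero] at h0 h₁
    linarith
  funext i
  exact Fin.cases hx0 key i

/-- If the product of an affine function with a coordinate is affine, then the function does not
depend on this coordinate. -/
theorem coeff_succ_eq_zero_of_mul_coord {c d : Fin (n + 1) → ℝ} {i : Fin n}
    {S : Set (EuclideanSpace ℝ (Fin n))} (hne : (interior S).Nonempty)
    (h : ∀ x ∈ S, affEval c x * x i = affEval d x) : c i.succ = 0 := by
  obtain ⟨x, hx⟩ := hne
  obtain ⟨t, ht, h₁, h₂⟩ :=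
    exists_pos_smul_mem_of_mem_interior hx (EuclideanSpace.single i (1 : ℝ))
  have e₀ := h x (interior_subset hx)
  have e₁ := h _ h₁
  have e₂ := h _ h₂
  rw [affEval_add_smul_single, affEval_add_smul_single, PiLp.add_apply, PiLp.smul_apply,
    PiLp.single_apply, if_pos rfl, smul_eq_mul, mul_one] at e₁ e₂
  -- The symmetric second difference along the `i`-th axis kills the affine right side and leaves `2
  -- t² c_i` on the left.
  have : t * t * c i.succ = 0 := by linarith
  exact (mul_eq_zero.1 this).resolve_left (by positivity)

/-- Affine functions are determined by their values on a set with nonempty interior. -/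
theorem eq_of_affEval_eq_on {c d : Fin (n + 1) → ℝ} {S : Set (EuclideanSpace ℝ (Fin n))}
    (hS : (interior S).Nonempty) (h : ∀ x ∈ S, affEval c x = affEval d x) : c = d := by
  obtain ⟨x, hx⟩ := hS
  refine sub_eq_zero.1 (eq_zero_of_nonneg_of_mem_interior hx (fun z hz => ?_) ?_)
  · rw [affEval_sub, h z hz, sub_self]
  · rw [affEval_sub, h x (interior_subset hx), sub_self]

/-- Closed conditions pass from the interior of a convex body to the body. -/
theorem mem_of_interior_subset {S T : Set (EuclideanSpace ℝ (Fin n))} (hconv : Convex ℝ S)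
    (hne : (interior S).Nonempty) (hT : IsClosed T) (h : interior S ⊆ T) : S ⊆ T := by
  have := hconv.closure_interior_eq_closure_of_nonempty_interior hne
  exact subset_closure.trans (this ▸ closure_minimal h hT)

/-- A function which is affine on a convex body is the restriction of an affine function. -/
theorem exists_affEval_eq_of_isAffineMap {S : Set (EuclideanSpace ℝ (Fin n))}
    (hconv : Convex ℝ S) (hne : (interior S).Nonempty) {f : S → ℝ} (hf : IsAffineMap f) :
    ∃ c : Fin (n + 1) → ℝ, ∀ x : S, f x = affEval c x := by
  obtain ⟨s, hsS, b, hb⟩ :=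
    AffineBasis.exists_affine_subbasis (hconv.interior_nonempty_iff_affineSpan_eq_top.1 hne)
  have : Finite s := b.finite
  have := Fintype.ofFinite s
  have hbS : ∀ i : s, b i ∈ S := fun i => by rw [hb]; exact hsS i.2
  let g : EuclideanSpace ℝ (Fin n) →ᵃ[ℝ] ℝ := 
    (∑ i : s, f ⟨b i, hbS i⟩ • LinearMap.proj (R := ℝ) (φ := fun _ : s => ℝ) i).toAffineMap.comp
      b.coords
  have hg : ∀ i : s, g (b i) = f ⟨b i, hbS i⟩ := by
    intro i
    simp [g, AffineBasis.coord_apply]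
  obtain ⟨c, hc⟩ := exists_affEval_eq (g 0) g.linear
  have hgc : ∀ x, g x = affEval c x := by
    intro x
    have := g.map_vadd 0 x
    simp only [vadd_eq_add, add_zero] at this
    rw [hc, this, add_comm]
  -- The agreement set is convex and contains an affine basis, hence it has interior points.
  let Z : Set (EuclideanSpace ℝ (Fin n)) := {x | ∃ h : x ∈ S, f ⟨x, h⟩ = affEval c x}
  have hZconv : Convex ℝ Z := by
    rintro x₁ ⟨h₁, e₁⟩ x₂ ⟨h₂, e₂⟩ p q hp hq hpq
    have hmem := hconv h₁ h₂ hp hq hpq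
    refine ⟨hmem, ?_⟩
    rw [hf ⟨x₁, h₁⟩ ⟨x₂, h₂⟩ ⟨_, hmem⟩ p q hp hq hpq rfl, e₁, e₂, affEval_combo c x₁ x₂ hpq]
    simp
  have hbZ : ∀ i : s, b i ∈ Z := fun i => ⟨hbS i, by rw [← hg, hgc]⟩
  have hZne : (interior Z).Nonempty := by
    rw [hZconv.interior_nonempty_iff_affineSpan_eq_top, eq_top_iff, ← b.tot]
    refine affineSpan_mono ℝ ?_
    rintro _ ⟨i, rfl⟩
    exact hbZ i
  refine ⟨c, fun ⟨x, hx⟩ => ?_⟩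
  obtain ⟨p, hp⟩ := hZne
  -- Moving slightly beyond `p`, away from `x`, stays in `Z`. Then `p` is a convex combination of
  -- that point and `x` with positive weight on `x`, which determines `f x`.
  obtain ⟨r, hr, ⟨hqS, hq⟩, -⟩ := exists_pos_smul_mem_of_mem_interior hp (p - x)
  obtain ⟨hpS, hpe⟩ := interior_subset hp
  have hcomb : p = (1 / (1 + r)) • (p + r • (p - x)) + (r / (1 + r)) • x := by
    ext j
    simp only [PiLp.add_apply, PiLp.smul_apply, PiLp.sub_apply, smul_eq_mul]
    field_simp
    ring
  have hsum : 1 / (1 + r) + r / (1 + r) = 1 := by field_simp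
  have e₁ := hf ⟨_, hqS⟩ ⟨x, hx⟩ ⟨p, hpS⟩ _ _ (by positivity) (by positivity) hsum hcomb
  have e₂ := affEval_combo c (p + r • (p - x)) x hsum
  rw [← hcomb] at e₂
  rw [hpe, hq, e₂, smul_eq_mul, smul_eq_mul] at e₁
  have hpos : r / (1 + r) ≠ 0 := by positivity
  exact (mul_left_cancel₀ hpos (by linarith)).symm

/-- Supporting hyperplanes of convex bodies, with normalized coefficients. -/
theorem exists_supporting_affEval {S : Set (EuclideanSpace ℝ (Fin n))} (hconv : Convex ℝ S)
    (hne : (interior S).Nonempty) {x : EuclideanSpace ℝ (Fin n)} (hx : x ∉ interior S) :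
    ∃ c : Fin (n + 1) → ℝ, ‖c‖ = 1 ∧ affEval c x = 0 ∧ ∀ z ∈ S, 0 ≤ affEval c z := by
  obtain ⟨f, hf⟩ := geometric_hahn_banach_open_point hconv.interior isOpen_interior hx
  obtain ⟨c, hc⟩ := exists_affEval_eq (f x) (-f : EuclideanSpace ℝ (Fin n) →ₗ[ℝ] ℝ)
  have hc' : ∀ z, affEval c z = f x - f z := fun z => by
    rw [hc]; simp [sub_eq_add_neg]
  have hc0 : c ≠ 0 := by
    rintro rfl
    obtain ⟨z, hz⟩ := hne
    have := hc' z
    rw [affEval_zero] at this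
    linarith [hf z hz]
  have hnn : S ⊆ {z | 0 ≤ affEval c z} :=
    mem_of_interior_subset hconv hne (isClosed_le continuous_const (continuous_affEval_right c))
      fun z hz => by
        change 0 ≤ affEval c z
        linarith [hf z hz, hc' z]
  refine ⟨‖c‖⁻¹ • c, ?_, ?_, fun z hz => ?_⟩
  · rw [norm_smul, norm_inv, norm_norm, inv_mul_cancel₀ (norm_ne_zero_iff.2 hc0)]
  · rw [affEval_smul, hc', sub_self, mul_zero]
  · rw [affEval_smul]
    exact mul_nonneg (by positivity) (hnn hz)

/-- Strict separation of a point from a closed convex set by an affine function. -/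
theorem exists_separating_affEval {S : Set (EuclideanSpace ℝ (Fin n))} (hconv : Convex ℝ S)
    (hS : IsClosed S) {x : EuclideanSpace ℝ (Fin n)} (hx : x ∉ S) :
    ∃ c : Fin (n + 1) → ℝ, affEval c x < 0 ∧ ∀ z ∈ S, 0 ≤ affEval c z := by
  obtain ⟨f, r, hr, hf⟩ := geometric_hahn_banach_point_closed hconv hS hx
  obtain ⟨c, hc⟩ := exists_affEval_eq (-r) (f : EuclideanSpace ℝ (Fin n) →ₗ[ℝ] ℝ)
  refine ⟨c, ?_, fun z hz => ?_⟩
  · rw [hc]; simpa using hr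
  · rw [hc]; simpa using (hf z hz).le

end AffEval

/-! ### Order unit spaces -/

section OrderUnit

variable {V : Type*} [AddCommGroup V] [Module ℝ V] {C : PointedCone ℝ V} {e : V}

theorem orderNorm_nonneg (C : PointedCone ℝ V) (e v : V) : 0 ≤ orderNorm C e v :=
  Real.sInf_nonneg fun _ h => h.1.le

theorem IsAOUSpace.unit_mem (h : IsAOUSpace C e) : e ∈ C := by
  obtain ⟨r, hr, hmem⟩ := h.order_unit 0
  have := PointedCone.smul_mem C (inv_nonneg.2 hr.le) hmem
  rwa [sub_zero, smul_smul, inv_mul_cancel₀ hr.ne', one_smul] at this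

theorem IsAOUSpace.smul_unit_add_mem_of_le (h : IsAOUSpace C e) {r s : ℝ} (hrs : r ≤ s) {v : V}
    (hv : r • e + v ∈ C) : s • e + v ∈ C := by
  have := C.add_mem (PointedCone.smul_mem C (sub_nonneg.2 hrs) h.unit_mem) hv
  rwa [← add_assoc, ← add_smul, sub_add_cancel] at this

theorem IsAOUSpace.exists_bound (h : IsAOUSpace C e) (v : V) :
    ∃ r : ℝ, 0 < r ∧ r • e - v ∈ C ∧ r • e + v ∈ C := by
  obtain ⟨r, hr, h₁⟩ := h.order_unit v
  obtain ⟨s, hs, h₂⟩ := h.order_unit (-v)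
  rw [sub_neg_eq_add] at h₂
  rw [sub_eq_add_neg] at h₁
  refine ⟨max r s, lt_max_of_lt_left hr, ?_, h.smul_unit_add_mem_of_le (le_max_right _ _) h₂⟩
  rw [sub_eq_add_neg]
  exact h.smul_unit_add_mem_of_le (le_max_left _ _) h₁

/-- The Archimedean property makes the infimum in the norm attained, even for `r = 0`. All norm
estimates below are reduced to cone membership in this way. -/
theorem IsAOUSpace.orderNorm_le_iff (h : IsAOUSpace C e) {v : V} {r : ℝ} (hr : 0 ≤ r) :
    orderNorm C e v ≤ r ↔ r • e - v ∈ C ∧ r • e + v ∈ C := by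
  have hbdd : BddBelow {r : ℝ | 0 < r ∧ r • e - v ∈ C ∧ r • e + v ∈ C} := ⟨0, fun _ h => h.1.le⟩
  constructor
  · intro hle
    have key : ∀ ε : ℝ, 0 < ε → (r + ε) • e - v ∈ C ∧ (r + ε) • e + v ∈ C := by
      intro ε hε
      obtain ⟨s, ⟨-, h₁, h₂⟩, hs⟩ := exists_lt_of_csInf_lt (h.exists_bound v)
        (show orderNorm C e v < r + ε by linarith)
      rw [sub_eq_add_neg] at h₁ ⊢
      exact ⟨h.smul_unit_add_mem_of_le hs.le h₁, h.smul_unit_add_mem_of_le hs.le h₂⟩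
    refine ⟨h.archimedean _ fun ε hε => ?_, h.archimedean _ fun ε hε => ?_⟩
    · convert (key ε hε).1 using 1; module
    · convert (key ε hε).2 using 1; module
  · rintro ⟨h₁, h₂⟩
    refine le_of_forall_pos_le_add fun ε hε => csInf_le hbdd ⟨by linarith, ?_, ?_⟩
    · rw [sub_eq_add_neg] at h₁ ⊢
      exact h.smul_unit_add_mem_of_le (by linarith) h₁
    · exact h.smul_unit_add_mem_of_le (by linarith) h₂

/-- Order bounds are compatible with scalar multiplication. -/
theorem smul_unit_add_smul_mem {N : ℝ} {w : V} (h₁ : N • e - w ∈ C) (h₂ : N • e + w ∈ C) (t : ℝ) :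
    (|t| * N) • e + t • w ∈ C := by
  rcases le_total 0 t with ht | ht
  · have := PointedCone.smul_mem C ht h₂
    rw [abs_of_nonneg ht]
    convert this using 1; module
  · have := PointedCone.smul_mem C (neg_nonneg.2 ht) h₁
    rw [abs_of_nonpos ht]
    convert this using 1; module

theorem tendsto_zero_iff_eventually_le {u : ℕ → ℝ} (hu : ∀ k, 0 ≤ u k) :
    Tendsto u atTop (𝓝 0) ↔ ∀ ε : ℝ, 0 < ε → ∀ᶠ k in atTop, u k ≤ ε := by
  constructor
  · intro h ε hε
    exact (h.eventually (gt_mem_nhds hε)).mono fun _ h => h.le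
  · intro h
    rw [Metric.tendsto_nhds]
    intro ε hε
    filter_upwards [h (ε / 2) (by linarith)] with k hk
    rw [Real.dist_eq, sub_zero, abs_of_nonneg (hu k)]
    linarith

end OrderUnit

/-! ### Duality for Archimedean order unit cones in `ℝ^(n+1)` -/

section ConeDuality

variable {n : ℕ} {C : PointedCone ℝ (Fin (n + 1) → ℝ)}

/-- The points of `ℝ^n` at which all affine functions in a cone are nonnegative. -/
def coneStates (C : PointedCone ℝ (Fin (n + 1) → ℝ)) : Set (EuclideanSpace ℝ (Fin n)) :=
  {x | ∀ c ∈ C, 0 ≤ affEval c x}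

theorem convex_coneStates : Convex ℝ (coneStates C) := by
  intro x hx y hy s t hs ht hst c hc
  rw [affEval_combo c x y hst]
  exact add_nonneg (mul_nonneg hs (hx c hc)) (mul_nonneg ht (hy c hc))

/-- The order unit dominates every unit vector, so `‖v‖ * S ≤ r` implies `r • e + v ∈ C`. A point
`c` of the closure therefore satisfies `r • e + c ∈ C` for all `r > 0`, and the Archimedean property
applies. -/
theorem IsAOUSpace.isClosed_cone (h : IsAOUSpace C (Pi.single 0 1)) :
    IsClosed (C : Set (Fin (n + 1) → ℝ)) := by
  choose N hN h₁ h₂ using fun j : Fin (n + 1) =>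
    h.exists_bound (Pi.single j (1 : ℝ) : Fin (n + 1) → ℝ)
  set S := ∑ j, N j with hSdef
  have hS : 0 < S := Finset.sum_pos (fun j _ => hN j) Finset.univ_nonempty
  have box : ∀ (r : ℝ) (v : Fin (n + 1) → ℝ), ‖v‖ * S ≤ r →
      r • (Pi.single 0 1 : Fin (n + 1) → ℝ) + v ∈ C := by
    intro r v hv
    have hsum : ∑ j, ((|v j| * N j) • (Pi.single 0 1 : Fin (n + 1) → ℝ)
        + v j • (Pi.single j 1 : Fin (n + 1) → ℝ)) ∈ C :=
      C.sum_mem fun j _ => smul_unit_add_smul_mem (h₁ j) (h₂ j) (v j)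
    rw [Finset.sum_add_distrib, ← Finset.sum_smul, ← pi_eq_sum_univ' v] at hsum
    refine h.smul_unit_add_mem_of_le (le_trans ?_ hv) hsum
    rw [hSdef, Finset.mul_sum]
    exact Finset.sum_le_sum fun j _ =>
      mul_le_mul_of_nonneg_right (norm_le_pi_norm v j) (hN j).le
  refine isClosed_of_closure_subset fun c hc => h.archimedean c fun r hr => ?_
  obtain ⟨d, hd, hdc⟩ := Metric.mem_closure_iff.1 hc (r / S) (by positivity)
  rw [dist_eq_norm, lt_div_iff₀ hS] at hdc
  have := C.add_mem (box r (c - d) hdc.le) hd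
  rwa [add_assoc, sub_add_cancel] at this

/-- The bipolar theorem for Archimedean order unit cones. -/
theorem IsAOUSpace.mem_iff_coneStates (h : IsAOUSpace C (Pi.single 0 1))
    (c : Fin (n + 1) → ℝ) : c ∈ C ↔ ∀ x ∈ coneStates C, 0 ≤ affEval c x := by
  refine ⟨fun hc x hx => hx c hc, fun hc => ?_⟩
  by_contra hcC
  have hconv : Convex ℝ (C : Set (Fin (n + 1) → ℝ)) := fun x hx y hy s t hs ht _ =>
    C.add_mem (PointedCone.smul_mem C hs hx) (PointedCone.smul_mem C ht hy)
  obtain ⟨f, r, hr, hf⟩ := geometric_hahn_banach_point_closed hconv h.isClosed_cone hcC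
  have hr0 : r < 0 := by simpa using hf 0 C.zero_mem
  -- If `f d < 0`, the multiple of `d` by `r / f d ≥ 0` lies in the cone and has value exactly `r`,
  -- against the strict separation.
  have hnn : ∀ d ∈ C, 0 ≤ f d := by
    intro d hd
    by_contra! hneg
    have := hf _ (PointedCone.smul_mem C (div_nonneg_of_nonpos hr0.le hneg.le) hd)
    rw [map_smul, smul_eq_mul, div_mul_cancel₀ _ hneg.ne] at this
    exact lt_irrefl _ this
  -- If `f` vanished at the unit, `N • e + c ∈ C` would give `f c ≥ 0`.
  have hunit : 0 < f (Pi.single 0 1) := by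
    refine lt_of_le_of_ne (hnn _ h.unit_mem) fun h0 => ?_
    obtain ⟨N, -, -, h₂⟩ := h.exists_bound c
    have := hnn _ h₂
    rw [map_add, map_smul, ← h0, smul_zero, zero_add] at this
    linarith
  -- Normalized at the unit, `f` is evaluation at a point of `ℝ^n`.
  have hexp : ∀ d : Fin (n + 1) → ℝ, f d = f (Pi.single 0 1) *
      affEval d (WithLp.toLp 2 fun i => f (Pi.single i.succ 1) / f (Pi.single 0 1)) := by
    intro d
    have := LinearMap.pi_apply_eq_sum_univ (f : (Fin (n + 1) → ℝ) →ₗ[ℝ] ℝ) d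
    have e : ∀ i : Fin (n + 1),
        (fun j => if i = j then (1 : ℝ) else 0) = (Pi.single i 1 : Fin (n + 1) → ℝ) := by
      intro i; funext j; simp [Pi.single_apply, eq_comm]
    simp only [e, ContinuousLinearMap.coe_coe] at this
    rw [this, Fin.sum_univ_succ, affEval, mul_add, Finset.mul_sum]
    congr 1
    · simp [mul_comm]
    · refine Finset.sum_congr rfl fun i _ => ?_
      simp only [smul_eq_mul]
      field_simp
  have hx := hc (WithLp.toLp 2 fun i => f (Pi.single i.succ 1) / f (Pi.single 0 1)) fun d hd => by
    have := hnn d hd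
    rw [hexp d] at this
    exact nonneg_of_mul_nonneg_right this hunit
  have := mul_nonneg hunit.le hx
  rw [← hexp] at this
  linarith

/-- If the states did not span `ℝ^n` affinely, a nonzero affine function would vanish on them; by
the bipolar theorem it and its negative would lie in the salient cone. The same argument with the
constant `1` excludes an empty state set. -/
theorem IsAOUSpace.interior_coneStates_nonempty (h : IsAOUSpace C (Pi.single 0 1)) :
    (interior (coneStates C)).Nonempty := by
  have key : ∀ c : Fin (n + 1) → ℝ, (∀ x ∈ coneStates C, affEval c x = 0) → c = 0 := by
    intro c hc
    refine h.salient c ((h.mem_iff_coneStates c).2 fun x hx => (hc x hx).ge)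
      ((h.mem_iff_coneStates _).2 fun x hx => ?_)
    rw [affEval_neg, hc x hx, neg_zero]
  have hne : (coneStates C).Nonempty := by
    by_contra hempty
    rw [Set.not_nonempty_iff_eq_empty] at hempty
    have := congrFun (key (Pi.single 0 1) (by simp [hempty])) 0
    simp at this
  rw [convex_coneStates.interior_nonempty_iff_affineSpan_eq_top]
  obtain ⟨p, hp⟩ := hne
  by_contra hspan
  have hp' : p ∈ affineSpan ℝ (coneStates C) := subset_affineSpan ℝ _ hp
  have hdir : (affineSpan ℝ (coneStates C)).direction < ⊤ := by
    refine lt_top_iff_ne_top.2 fun htop => hspan ?_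
    exact (AffineSubspace.direction_eq_top_iff_of_nonempty ⟨p, hp'⟩).1 htop
  obtain ⟨f, hf0, hf⟩ := Submodule.exists_le_ker_of_lt_top _ hdir
  obtain ⟨c, hc⟩ := exists_affEval_eq (-f p) f
  have hc0 := key c fun x hx => by
    have := hf (AffineSubspace.vsub_mem_direction (subset_affineSpan ℝ _ hx) hp')
    rw [LinearMap.mem_ker, vsub_eq_sub, map_sub] at this
    rw [hc]; linarith
  refine hf0 (LinearMap.ext fun v => ?_)
  have h₁ := hc v
  have h₂ := hc 0
  rw [hc0, affEval_zero] at h₁ h₂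
  rw [map_zero] at h₂
  rw [LinearMap.zero_apply]
  linarith

end ConeDuality

/-! ### Compact regular partially convex sets -/

section CompactRegular

variable {n m : ℕ} {K : Set (EuclideanSpace ℝ (Fin n) × EuclideanSpace ℝ (Fin m))}

theorem isCompact_projY (hK : IsCompact K) : IsCompact (projY K) := by
  have : projY K = Prod.snd '' K := by
    ext y; simp [projY]
  exact this ▸ hK.image continuous_snd

/-- The projection of a set of pairs onto its base. -/
def toBase (K : Set (EuclideanSpace ℝ (Fin n) × EuclideanSpace ℝ (Fin m))) : C(K, projY K) where
  toFun z := ⟨z.1.2, z.1.1, z.2⟩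
  continuous_toFun := by fun_prop

/-- A point of the slice over `y`, as a point of `K`. -/
def ofSlice {y : projY K} {x : EuclideanSpace ℝ (Fin n)} (hx : x ∈ slice K (y : _)) : K :=
  ⟨(x, y), hx⟩

theorem mem_slice_of_toBase_eq {z : K} {y : projY K} (h : toBase K z = y) :
    z.1.1 ∈ slice K (y : _) := by
  subst h; exact z.2

theorem isClosed_slice (hR : IsRegularPartiallyConvex K) (y : EuclideanSpace ℝ (Fin m)) :
    IsClosed (slice K y) :=
  hR.isClosed.preimage (Continuous.prodMk_left y)

/-- The projection from the compact `K` is a closed map; this is upper hemicontinuity of the slices.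
-/
theorem eventually_fiber_subset (hK : IsCompact K) {U : Set K} (hU : IsOpen U) {y : projY K}
    (h : ∀ z : K, toBase K z = y → z ∈ U) :
    ∀ᶠ y' in 𝓝 y, ∀ z : K, toBase K z = y' → z ∈ U := by
  have : CompactSpace K := isCompact_iff_compactSpace.1 hK
  have hcl : IsClosed (toBase K '' Uᶜ) :=
    (hU.isClosed_compl.isCompact.image (toBase K).continuous).isClosed
  have hy : y ∈ (toBase K '' Uᶜ)ᶜ := by
    rintro ⟨z, hz, rfl⟩
    exact hz (h z rfl)
  filter_upwards [hcl.isOpen_compl.mem_nhds hy] with y' hy' z hz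
  by_contra hzU
  exact hy' ⟨z, hzU, hz⟩

/-- The coefficients of an affine function are controlled by its values on a slice, uniformly
over the base. -/
theorem exists_coeff_bound (hK : IsCompact K) (hR : IsRegularPartiallyConvex K) :
    ∃ B : ℝ, 0 < B ∧ ∀ y ∈ projY K, ∀ (c : Fin (n + 1) → ℝ) (r : ℝ),
      (∀ x ∈ slice K y, |affEval c x| ≤ r) → ‖c‖ ≤ B * r := by
  by_contra! hcon
  choose y hy c r hr hc using fun k : ℕ => hcon (k + 1) (by positivity)
  have hr0 : ∀ k, 0 ≤ r k := fun k => by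
    obtain ⟨x, hx⟩ := hy k
    exact (abs_nonneg _).trans (hr k x hx)
  have hcpos : ∀ k, 0 < ‖c k‖ := fun k =>
    lt_of_le_of_lt (mul_nonneg (by positivity) (hr0 k)) (hc k)
  -- A failing sequence is normalized: unit vectors `d k` whose values on the slices are at most `1
  -- / (k + 1)`.
  set d : ℕ → Fin (n + 1) → ℝ := fun k => ‖c k‖⁻¹ • c k with hd
  have hd1 : ∀ k, d k ∈ Metric.sphere (0 : Fin (n + 1) → ℝ) 1 := fun k => by
    rw [mem_sphere_zero_iff_norm, hd, norm_smul, norm_inv, norm_norm,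
      inv_mul_cancel₀ (hcpos k).ne']
  have hdle : ∀ k, ∀ x ∈ slice K (y k), |affEval (d k) x| ≤ 1 / ((k : ℝ) + 1) := by
    intro k x hx
    rw [hd, affEval_smul, abs_mul, abs_inv, abs_norm, inv_mul_le_iff₀ (hcpos k), mul_one_div,
      le_div_iff₀ (by positivity)]
    have := hr k x hx
    have h₂ : |affEval (c k) x| * ((k : ℝ) + 1) ≤ r k * (k + 1) :=
      mul_le_mul_of_nonneg_right this (by positivity)
    linarith [hc k]
  obtain ⟨⟨y₀, d₀⟩, ⟨hy₀, hd₀⟩, κ, hκ, hlim⟩ :=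
    ((isCompact_projY hK).prod (isCompact_sphere (0 : Fin (n + 1) → ℝ) 1)).tendsto_subseq
      (x := fun k => (y k, d k)) fun k => ⟨hy k, hd1 k⟩
  have hylim : Tendsto (fun k => y (κ k)) atTop (𝓝 y₀) := (continuous_fst.tendsto _).comp hlim
  have hdlim : Tendsto (fun k => d (κ k)) atTop (𝓝 d₀) := (continuous_snd.tendsto _).comp hlim
  -- Lower hemicontinuity approximates each interior point of the limit slice by points of the
  -- slices over `y (κ k)`, so the limit function vanishes on a nonempty open set.
  have hzero : d₀ = 0 := by
    refine eq_of_affEval_eq_on (S := interior (slice K y₀)) ?_ fun x hx => ?_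
    · rw [interior_interior]; exact hR.interior_nonempty y₀ hy₀
    obtain ⟨xs, hxs, hxlim⟩ := hR.lhc y₀ hy₀ (fun k => y (κ k)) (fun k => hy _) hylim x hx
    have h₁ : Tendsto (fun k => affEval (d (κ k)) (xs k)) atTop (𝓝 (affEval d₀ x)) :=
      (continuous_affEval.tendsto (d₀, x)).comp (hdlim.prodMk_nhds hxlim)
    have h₂ : Tendsto (fun k => affEval (d (κ k)) (xs k)) atTop (𝓝 0) :=
      squeeze_zero_norm (fun k => hdle _ _ (interior_subset (hxs k)))
        (tendsto_one_div_add_atTop_nhds_zero_nat.comp hκ.tendsto_atTop)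
    rw [tendsto_nhds_unique h₁ h₂, affEval_zero]
  rw [hzero, mem_sphere_zero_iff_norm, norm_zero] at hd₀
  exact zero_ne_one hd₀

theorem Caff.isAffineMap (f : Caff K) (y : EuclideanSpace ℝ (Fin m)) :
    IsAffineMap (S := slice K y) fun x => (f : C(K, ℝ)) ⟨((x : _), y), x.2⟩ := f.2 y

/-- Every continuous partially affine function on a compact regular partially convex set has
continuous coefficients. -/
theorem exists_continuous_coeff (hK : IsCompact K) (hR : IsRegularPartiallyConvex K)
    (f : Caff K) : ∃ c : Fin (n + 1) → C(projY K, ℝ),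
      ∀ z : K, (f : C(K, ℝ)) z = affEval (fun i => c i (toBase K z)) z.1.1 := by
  choose c hc using fun y : projY K => exists_affEval_eq_of_isAffineMap
    (hR.partiallyConvex y y.2) (hR.interior_nonempty y y.2) (Caff.isAffineMap f y)
  have hc' : ∀ z : K, (f : C(K, ℝ)) z = affEval (c (toBase K z)) z.1.1 :=
    fun z => hc (toBase K z) ⟨z.1.1, z.2⟩
  obtain ⟨B, hB, hbound⟩ := exists_coeff_bound hK hR
  have hcont : Continuous c := by
    rw [continuous_iff_continuousAt]
    intro y
    rw [ContinuousAt, Metric.tendsto_nhds]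
    intro ε hε
    -- Freezing the coefficients at `y` gives a function that agrees with `f` over `y`, hence is
    -- close to it over nearby `y'`. There the difference is affine with coefficients `c y' - c y`,
    -- to which the uniform bound applies.
    have hg : Continuous fun z : K => |(f : C(K, ℝ)) z - affEval (c y) z.1.1| :=
      (((f : C(K, ℝ)).continuous).sub ((continuous_affEval_right _).comp (by fun_prop))).abs
    have hopen : IsOpen {z : K | |(f : C(K, ℝ)) z - affEval (c y) z.1.1| < ε / (2 * B)} :=
      isOpen_lt hg continuous_const
    filter_upwards [eventually_fiber_subset hK hopen (y := y) fun z hz => by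
      change |(f : C(K, ℝ)) z - affEval (c y) z.1.1| < ε / (2 * B)
      rw [hc', hz, sub_self, abs_zero]; positivity] with y' hy'
    rw [dist_eq_norm]
    have := hbound y' y'.2 (c y' - c y) (ε / (2 * B)) fun x hx => by
      have := hy' (ofSlice hx) rfl
      change |(f : C(K, ℝ)) (ofSlice hx) - affEval (c y) x| < ε / (2 * B) at this
      rw [hc'] at this
      rw [affEval_sub]
      exact this.le
    have h₂ : B * (ε / (2 * B)) = ε / 2 := by field_simp
    linarith
  exact ⟨fun i => ⟨fun y => c y i, (continuous_apply i).comp hcont⟩, hc'⟩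

theorem continuous_coeff_unique (hR : IsRegularPartiallyConvex K)
    {c d : Fin (n + 1) → C(projY K, ℝ)}
    (h : ∀ z : K, affEval (fun i => c i (toBase K z)) z.1.1
      = affEval (fun i => d i (toBase K z)) z.1.1) : c = d := by
  funext i
  ext y
  exact congrFun (eq_of_affEval_eq_on (c := fun i => c i y) (d := fun i => d i y)
    (hR.interior_nonempty y y.2) fun x hx => h (ofSlice hx)) i

/-- A continuous function on `K` which is nonnegative over a point of the base becomes
nonnegative on `K` after adding a function on the base that vanishes at this point. -/
theorem exists_base_correction (hK : IsCompact K) (hR : IsRegularPartiallyConvex K)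
    (f : C(K, ℝ)) (y₀ : projY K) (hf : ∀ z : K, toBase K z = y₀ → 0 ≤ f z) :
    ∃ h : C(projY K, ℝ), h y₀ = 0 ∧ ∀ z : K, 0 ≤ f z + h (toBase K z) := by
  have : CompactSpace K := isCompact_iff_compactSpace.1 hK
  set F : C(K, ℝ) := ⟨fun z => max (-f z) 0, by fun_prop⟩ with hF
  have hFz : ∀ z, F z = max (-f z) 0 := fun _ => rfl
  -- The correction is the largest negative part of `f` on each slice.
  set h : projY K → ℝ := fun y => sSup (F '' {z | toBase K z = y}) with hh
  have hbdd : ∀ y, BddAbove (F '' {z | toBase K z = y}) := fun y =>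
    (isCompact_range F.continuous).bddAbove.mono (Set.image_subset_range _ _)
  have hle : ∀ z : K, F z ≤ h (toBase K z) := fun z => le_csSup (hbdd _) ⟨z, rfl, rfl⟩
  have hne : ∀ y : projY K, (F '' {z | toBase K z = y}).Nonempty := fun y => by
    obtain ⟨x, hx⟩ := y.2
    exact ⟨_, ofSlice hx, rfl, rfl⟩
  have hcont : Continuous h := by
    refine continuous_iff_seqContinuous.2 fun ys y hys => tendsto_order.2 ⟨fun a ha => ?_,
      fun b hb => ?_⟩
    -- Lower semicontinuity: a point where `F > a` can be taken in the interior of its slice and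
    -- then followed to nearby slices.
    · obtain ⟨_, ⟨z, hz, rfl⟩, haz⟩ := exists_lt_of_lt_csSup (hne y) ha
      obtain ⟨x, hx, hax⟩ : ∃ x, ∃ hx : x ∈ interior (slice K (y : _)),
          a < F (ofSlice (interior_subset hx)) := by
        by_contra! hcon
        have hcl : IsClosed {x | (x, (y : EuclideanSpace ℝ (Fin m))) ∈
            Subtype.val '' {z : K | F z ≤ a}} :=
          (hR.isClosed.isClosedEmbedding_subtypeVal.isClosedMap _
            (isClosed_le F.continuous continuous_const)).preimage (Continuous.prodMk_left _)
        obtain ⟨w, hw, hwz⟩ := mem_of_interior_subset (hR.partiallyConvex y y.2)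
          (hR.interior_nonempty y y.2) hcl (fun x hx => ⟨_, hcon x hx, rfl⟩)
          (mem_slice_of_toBase_eq hz)
        have e : w = z := by
          subst hz; exact Subtype.ext hwz
        rw [← e] at haz
        exact haz.not_ge hw
      obtain ⟨xs, hxs, hxlim⟩ := hR.lhc y y.2 (fun k => ys k) (fun k => (ys k).2)
        ((continuous_subtype_val.tendsto _).comp hys) x hx
      have hlim : Tendsto (fun k => F (ofSlice (y := ys k) (interior_subset (hxs k)))) atTop
          (𝓝 (F (ofSlice (interior_subset hx)))) := by
        refine (F.continuous.tendsto _).comp (tendsto_subtype_rng.2 ?_)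
        exact hxlim.prodMk_nhds ((continuous_subtype_val.tendsto _).comp hys)
      filter_upwards [hlim.eventually (lt_mem_nhds hax)] with k hk
      exact hk.trans_le (hle (ofSlice (y := ys k) (interior_subset (hxs k))))
    -- Upper semicontinuity comes from compactness; the intermediate `b'` keeps the inequality
    -- strict after taking the supremum.
    · obtain ⟨b', hb', hbb'⟩ := exists_between hb
      refine hys.eventually (p := fun y' => h y' < b) ?_
      filter_upwards [eventually_fiber_subset hK (isOpen_lt F.continuous continuous_const)
        (y := y) fun z hz => (show F z < b' from (hz ▸ hle z).trans_lt hb')] with y' hy'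
      refine (csSup_le (hne y') ?_).trans_lt hbb'
      rintro _ ⟨z, hz, rfl⟩
      exact (hy' z hz).le
  refine ⟨⟨h, hcont⟩, ?_, fun z => ?_⟩
  · refine le_antisymm (csSup_le (hne y₀) ?_) ?_
    · rintro _ ⟨z, hz, rfl⟩
      rw [hFz, max_eq_right (neg_nonpos.2 (hf z hz))]
    · obtain ⟨_, z, hz, rfl⟩ := hne y₀
      have := hle z
      rw [hz] at this
      exact (le_max_right _ _).trans this
  · have := (le_max_left _ _).trans (hle z)
    change 0 ≤ f z + h (toBase K z)
    linarith

end CompactRegular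

/-! ### The module structure and the fibers -/

namespace OrderUnitModule

variable {m : ℕ} {A : Type u} {X : Type v} [AddCommGroup A] [Module ℝ A] [TopologicalSpace X]
  (D : OrderUnitModule m A X)

instance : CompactSpace D.Y := isCompact_iff_compactSpace.1 D.isCompact_Y

theorem act_eq_of_emb {g : C(D.Y, ℝ)} {a b : A} (h : D.emb b = D.emb (D.incl g) * D.emb a) :
    D.act g a = b :=
  D.emb_injective (by rw [D.emb_act, h])

theorem act_add_left (f g : C(D.Y, ℝ)) (a : A) : D.act (f + g) a = D.act f a + D.act g a :=
  D.act_eq_of_emb (by simp only [map_add, D.emb_act, add_mul])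

theorem act_smul_left (r : ℝ) (f : C(D.Y, ℝ)) (a : A) : D.act (r • f) a = r • D.act f a :=
  D.act_eq_of_emb (by simp only [map_smul, D.emb_act, smul_mul_assoc])

theorem act_add_right (f : C(D.Y, ℝ)) (a b : A) : D.act f (a + b) = D.act f a + D.act f b :=
  D.act_eq_of_emb (by simp only [map_add, D.emb_act, mul_add])

theorem act_smul_right (r : ℝ) (f : C(D.Y, ℝ)) (a : A) : D.act f (r • a) = r • D.act f a :=
  D.act_eq_of_emb (by simp only [map_smul, D.emb_act, mul_smul_comm])

theorem act_act (f g : C(D.Y, ℝ)) (a : A) : D.act f (D.act g a) = D.act (f * g) a :=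
  (D.act_eq_of_emb (by simp only [D.emb_act, D.incl_mul, mul_assoc])).symm

theorem act_one (a : A) : D.act 1 a = a :=
  D.act_eq_of_emb (by rw [D.incl_one, D.emb_unit, one_mul])

theorem act_zero_left (a : A) : D.act 0 a = 0 :=
  D.act_eq_of_emb (by simp)

/-- `act` as a linear map in the second variable. -/
noncomputable def actHom (f : C(D.Y, ℝ)) : A →ₗ[ℝ] A where
  toFun := D.act f
  map_add' := D.act_add_right f
  map_smul' r := D.act_smul_right r f

theorem act_sum_right {ι : Type*} (s : Finset ι) (f : C(D.Y, ℝ)) (a : ι → A) :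
    D.act f (∑ i ∈ s, a i) = ∑ i ∈ s, D.act f (a i) :=
  map_sum (D.actHom f) a s

/-- Only multiplicativity of the inclusion is given; positivity follows because nonnegative
functions are squares. -/
theorem emb_incl_nonneg {f : C(D.Y, ℝ)} (hf : ∀ y, 0 ≤ f y) (t : X) : 0 ≤ D.emb (D.incl f) t := by
  set g : C(D.Y, ℝ) := ⟨fun y => Real.sqrt (f y), by fun_prop⟩
  have : f = g * g := by
    ext y; exact (Real.mul_self_sqrt (hf y)).symm
  rw [this, D.incl_mul]
  exact mul_self_nonneg _

theorem emb_incl_mono {f g : C(D.Y, ℝ)} (h : ∀ y, f y ≤ g y) (t : X) :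
    D.emb (D.incl f) t ≤ D.emb (D.incl g) t := by
  have := D.emb_incl_nonneg (f := g - f) (fun y => sub_nonneg.2 (h y)) t
  rw [map_sub, map_sub, ContinuousMap.sub_apply] at this
  linarith

theorem emb_incl_smul_one (r : ℝ) (t : X) : D.emb (D.incl (r • 1)) t = r := by
  rw [map_smul, map_smul, D.incl_one, D.emb_unit]; simp

/-- The absolute value of a function on the base. -/
def absBase (f : C(D.Y, ℝ)) : C(D.Y, ℝ) := ⟨fun y => |f y|, by fun_prop⟩

theorem abs_emb_incl_le (f : C(D.Y, ℝ)) (t : X) :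
    |D.emb (D.incl f) t| ≤ D.emb (D.incl (D.absBase f)) t := by
  rw [abs_le']
  refine ⟨D.emb_incl_mono (fun y => le_abs_self _) t, ?_⟩
  have := D.emb_incl_mono (f := -f) (g := D.absBase f) (fun y => neg_le_abs _) t
  rwa [map_neg, map_neg, ContinuousMap.neg_apply] at this

theorem abs_emb_le_iff {a : A} {N : ℝ} :
    (N • D.unit - a ∈ D.pos ∧ N • D.unit + a ∈ D.pos) ↔ ∀ t, |D.emb a t| ≤ N := by
  simp only [D.mem_pos_iff_emb, map_sub, map_add, map_smul, D.emb_unit, ← forall_and]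
  refine forall_congr' fun t => ?_
  simp only [ContinuousMap.sub_apply, ContinuousMap.add_apply, ContinuousMap.smul_apply,
    ContinuousMap.one_apply, smul_eq_mul, mul_one, abs_le]
  constructor <;> rintro ⟨h₁, h₂⟩ <;> constructor <;> linarith

theorem exists_emb_bound (a : A) : ∃ N : ℝ, 0 < N ∧ ∀ t, |D.emb a t| ≤ N := by
  obtain ⟨N, hN, h⟩ := D.isAOUSpace.exists_bound a
  exact ⟨N, hN, D.abs_emb_le_iff.1 h⟩

theorem abs_emb_act_le {a : A} {N : ℝ} {t : X} (h : |D.emb a t| ≤ N) (f : C(D.Y, ℝ)) :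
    |D.emb (D.act f a) t| ≤ D.emb (D.incl (N • D.absBase f)) t := by
  rw [D.emb_act, ContinuousMap.mul_apply, abs_mul, map_smul, map_smul, ContinuousMap.smul_apply,
    smul_eq_mul, mul_comm N]
  exact mul_le_mul (D.abs_emb_incl_le f t) h (abs_nonneg _)
    ((abs_nonneg _).trans (D.abs_emb_incl_le f t))

theorem isOrderIdeal_fiberIdeal (y : D.Y) : IsOrderIdeal D.pos (D.fiberIdeal y) := by
  intro p q hp hpq hq
  rw [fiberIdeal, closedOrderIdealSpan, Submodule.mem_sInf] at hq ⊢
  exact fun J hJ => hJ.1 p q hp hpq (hq J hJ)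

theorem incl_mem_fiberIdeal {y : D.Y} {f : C(D.Y, ℝ)} (hf : f y = 0) :
    D.incl f ∈ D.fiberIdeal y := by
  rw [fiberIdeal, closedOrderIdealSpan, Submodule.mem_sInf]
  exact fun J hJ => hJ.2.2 ⟨f, hf, rfl⟩

theorem fiberIdeal_le {y : D.Y} {J : Submodule ℝ A} (h₁ : IsOrderIdeal D.pos J)
    (h₂ : IsOrderNormClosed D.pos D.unit J) (h₃ : ∀ f : C(D.Y, ℝ), f y = 0 → D.incl f ∈ J) :
    D.fiberIdeal y ≤ J := by
  refine sInf_le ⟨h₁, h₂, ?_⟩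
  rintro _ ⟨f, hf, rfl⟩
  exact h₃ f hf

/-- With `|a| ≤ N`, the element `f · a` lies between `-N|f|` and `N|f|`, and `N|f|` is in the ideal.
Order ideals only control positive elements, hence the shift `0 ≤ f · a + N|f| ≤ 2N|f|`. -/
theorem act_mem_fiberIdeal {y : D.Y} {f : C(D.Y, ℝ)} (hf : f y = 0) (a : A) :
    D.act f a ∈ D.fiberIdeal y := by
  obtain ⟨N, hN, ha⟩ := D.exists_emb_bound a
  have hb : D.incl (N • D.absBase f) ∈ D.fiberIdeal y :=
    D.incl_mem_fiberIdeal (by simp [absBase, hf])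
  have h₁ : D.act f a + D.incl (N • D.absBase f) ∈ D.fiberIdeal y := by
    refine D.isOrderIdeal_fiberIdeal y _ (D.incl (N • D.absBase f) + D.incl (N • D.absBase f))
      ?_ ?_ (Submodule.add_mem _ hb hb)
    · rw [D.mem_pos_iff_emb]
      intro t
      have := (abs_le.1 (D.abs_emb_act_le (ha t) f)).1
      rw [map_add, ContinuousMap.add_apply]
      linarith
    · rw [D.mem_pos_iff_emb]
      intro t
      have := (abs_le.1 (D.abs_emb_act_le (ha t) f)).2
      rw [map_sub, map_add, map_add, ContinuousMap.sub_apply, ContinuousMap.add_apply,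
        ContinuousMap.add_apply]
      linarith
  simpa using Submodule.sub_mem _ h₁ hb

theorem toFiber_eq_zero_iff {y : D.Y} {a : A} : D.toFiber y a = 0 ↔ a ∈ D.fiberIdeal y :=
  Submodule.Quotient.mk_eq_zero _

theorem toFiber_surjective (y : D.Y) : Function.Surjective (D.toFiber y) :=
  Submodule.mkQ_surjective _

theorem mem_fiberPos_iff {y : D.Y} {b : D.Fiber y} :
    b ∈ D.fiberPos y ↔ ∃ p ∈ D.pos, D.toFiber y p = b := PointedCone.mem_map

theorem toFiber_mem_fiberPos {y : D.Y} {a : A} (ha : a ∈ D.pos) :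
    D.toFiber y a ∈ D.fiberPos y := D.mem_fiberPos_iff.2 ⟨a, ha, rfl⟩

theorem toFiber_act (y : D.Y) (f : C(D.Y, ℝ)) (a : A) :
    D.toFiber y (D.act f a) = f y • D.toFiber y a := by
  have h := D.act_mem_fiberIdeal (y := y) (f := f + (-f y) • 1) (by simp) a
  rw [← D.toFiber_eq_zero_iff, D.act_add_left, D.act_smul_left, D.act_one, map_add, map_smul,
    neg_smul, ← sub_eq_add_neg, sub_eq_zero] at h
  exact h

end OrderUnitModule

/-! ### Coefficients, and the fibers as copies of `ℝ^(n+1)` -/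

namespace FreeOrderUnitModule

variable {n m : ℕ} {A : Type u} {X : Type v} [AddCommGroup A] [Module ℝ A] [TopologicalSpace X]
  (M : FreeOrderUnitModule n m A X)

theorem basis_zero : M.basis 0 = M.unit := by
  rw [M.unit_eq, M.act_one]

/-- The coefficients of an element with respect to the basis. -/
noncomputable def coeffFun (a : A) : Fin (n + 1) → C(M.Y, ℝ) :=
  (M.existsUnique_coeff a).choose

theorem sum_coeffFun (a : A) : ∑ i, M.act (M.coeffFun a i) (M.basis i) = a :=
  (M.existsUnique_coeff a).choose_spec.1.symm

theorem coeffFun_eq {a : A} {c : Fin (n + 1) → C(M.Y, ℝ)}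
    (h : ∑ i, M.act (c i) (M.basis i) = a) : M.coeffFun a = c :=
  ((M.existsUnique_coeff a).choose_spec.2 c h.symm).symm

/-- The coefficient map. -/
noncomputable def coeff : A →ₗ[ℝ] Fin (n + 1) → C(M.Y, ℝ) where
  toFun := M.coeffFun
  map_add' a b := M.coeffFun_eq (by
    simp only [Pi.add_apply, M.act_add_left, Finset.sum_add_distrib, M.sum_coeffFun])
  map_smul' r a := M.coeffFun_eq (by
    simp only [Pi.smul_apply, M.act_smul_left, ← Finset.smul_sum, M.sum_coeffFun,
      RingHom.id_apply])

theorem sum_coeff (a : A) : ∑ i, M.act (M.coeff a i) (M.basis i) = a := M.sum_coeffFun a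

theorem coeff_eq {a : A} {c : Fin (n + 1) → C(M.Y, ℝ)}
    (h : ∑ i, M.act (c i) (M.basis i) = a) : M.coeff a = c := M.coeffFun_eq h

/-- The values of the coefficients at a point of the base. -/
noncomputable def coeffAt (y : M.Y) : A →ₗ[ℝ] Fin (n + 1) → ℝ where
  toFun a i := M.coeff a i y
  map_add' a b := by funext i; simp
  map_smul' r a := by funext i; simp

theorem coeffAt_apply (y : M.Y) (a : A) (i : Fin (n + 1)) : M.coeffAt y a i = M.coeff a i y := rfl

theorem coeffAt_act (y : M.Y) (g : C(M.Y, ℝ)) (a : A) :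
    M.coeffAt y (M.act g a) = g y • M.coeffAt y a := by
  have : M.coeff (M.act g a) = fun i => g * M.coeff a i := M.coeff_eq (by
    conv_rhs => rw [← M.sum_coeff a]
    rw [M.act_sum_right]
    simp only [M.act_act])
  funext i
  simp [coeffAt_apply, this]

theorem coeffAt_basis (y : M.Y) (j : Fin (n + 1)) : M.coeffAt y (M.basis j) = Pi.single j 1 := by
  have : M.coeff (M.basis j) = Pi.single j 1 := M.coeff_eq (by
    rw [Finset.sum_eq_single j]
    · rw [Pi.single_eq_same, M.act_one]
    · intro i _ hij
      rw [Pi.single_eq_of_ne hij, M.act_zero_left]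
    · simp)
  funext i
  rw [coeffAt_apply, this]
  by_cases h : i = j
  · subst h; simp
  · simp [h]

theorem coeffAt_unit (y : M.Y) : M.coeffAt y M.unit = Pi.single 0 1 := by
  rw [← M.basis_zero, M.coeffAt_basis]

theorem toFiber_eq_sum (y : M.Y) (a : A) :
    M.toFiber y a = ∑ i, M.coeffAt y a i • M.toFiber y (M.basis i) := by
  conv_lhs => rw [← M.sum_coeff a]
  simp only [map_sum, M.toFiber_act, coeffAt_apply]

/-- The `n + 1` classes span a fiber of dimension `n + 1`. Consequently `J_y` consists exactly of
the elements whose coefficients vanish at `y`. -/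
theorem linearIndependent_toFiber_basis (y : M.Y) :
    LinearIndependent ℝ fun i => M.toFiber y (M.basis i) := by
  refine linearIndependent_of_top_le_span_of_card_eq_finrank ?_ ?_
  · rintro b -
    obtain ⟨a, rfl⟩ := M.toFiber_surjective y b
    rw [M.toFiber_eq_sum]
    exact Submodule.sum_mem _ fun i _ => Submodule.smul_mem _ _ (Submodule.subset_span ⟨i, rfl⟩)
  · rw [M.fiber_finrank, Fintype.card_fin]

theorem toFiber_eq_zero_iff_coeffAt {y : M.Y} {a : A} :
    M.toFiber y a = 0 ↔ M.coeffAt y a = 0 := by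
  constructor
  · intro h
    rw [M.toFiber_eq_sum] at h
    funext i
    exact Fintype.linearIndependent_iff.1 (M.linearIndependent_toFiber_basis y) _ h i
  · intro h
    rw [M.toFiber_eq_sum, h]
    simp

theorem toFiber_eq_iff_coeffAt {y : M.Y} {a b : A} :
    M.toFiber y a = M.toFiber y b ↔ M.coeffAt y a = M.coeffAt y b := by
  rw [← sub_eq_zero, ← map_sub, M.toFiber_eq_zero_iff_coeffAt, map_sub, sub_eq_zero]

/-- The element with constant coefficients `c`. -/
noncomputable def ofConst (c : Fin (n + 1) → ℝ) : A := ∑ i, c i • M.basis i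

theorem coeffAt_ofConst (y : M.Y) (c : Fin (n + 1) → ℝ) : M.coeffAt y (M.ofConst c) = c := by
  simp only [ofConst, map_sum, map_smul, coeffAt_basis]
  exact (pi_eq_sum_univ' c).symm

/-! ### State spaces in coordinates -/

/-- The functional on `A` given by evaluation at `(x, y)`. -/
noncomputable def evalFun (x : EuclideanSpace ℝ (Fin n)) (y : M.Y) : A →ₗ[ℝ] ℝ where
  toFun a := affEval (M.coeffAt y a) x
  map_add' a b := by rw [map_add, affEval_add]
  map_smul' r a := by rw [map_smul, affEval_smul]; rfl

theorem evalFun_apply (x : EuclideanSpace ℝ (Fin n)) (y : M.Y) (a : A) :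
    M.evalFun x y a = affEval (M.coeffAt y a) x := rfl

theorem isFiberState_evalFun {x : EuclideanSpace ℝ (Fin n)} {y : M.Y}
    (h : ∀ a ∈ M.pos, 0 ≤ affEval (M.coeffAt y a) x) : M.IsFiberState y (M.evalFun x y) where
  nonneg := h
  map_unit := by rw [evalFun_apply, coeffAt_unit, affEval_single_zero]
  map_act g a := by rw [evalFun_apply, coeffAt_act, affEval_smul, evalFun_apply]

theorem eq_evalFun_of_isFiberState {y : M.Y} {Φ : A →ₗ[ℝ] ℝ} (h : M.IsFiberState y Φ)
    {x : EuclideanSpace ℝ (Fin n)} (hx : ∀ i, x i = Φ (M.basis i.succ)) : Φ = M.evalFun x y := by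
  ext a
  conv_lhs => rw [← M.sum_coeff a]
  rw [map_sum, Fin.sum_univ_succ, h.map_act, M.basis_zero, h.map_unit, mul_one, evalFun_apply,
    affEval]
  simp only [h.map_act, hx, coeffAt_apply]

theorem evalFun_basis_succ (x : EuclideanSpace ℝ (Fin n)) (y : M.Y) (i : Fin n) :
    M.evalFun x y (M.basis i.succ) = x i := by
  rw [evalFun_apply, coeffAt_basis, affEval_single_succ, one_mul]

theorem mem_coordStateSpace_iff {x : EuclideanSpace ℝ (Fin n)} {y : EuclideanSpace ℝ (Fin m)} :
    (x, y) ∈ M.coordStateSpace ↔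
      ∃ hy : y ∈ M.Y, ∀ a ∈ M.pos, 0 ≤ affEval (M.coeffAt ⟨y, hy⟩ a) x := by
  constructor
  · rintro ⟨hy, Φ, hΦ, hx⟩
    refine ⟨hy, fun a ha => ?_⟩
    rw [← evalFun_apply, ← M.eq_evalFun_of_isFiberState hΦ hx]
    exact hΦ.nonneg a ha
  · rintro ⟨hy, h⟩
    exact ⟨hy, M.evalFun x ⟨y, hy⟩, M.isFiberState_evalFun h,
      fun i => (M.evalFun_basis_succ _ _ _).symm⟩

theorem mem_stateSpace_iff {φ : A → ℝ} {y : EuclideanSpace ℝ (Fin m)} :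
    (φ, y) ∈ M.stateSpace ↔ ∃ (hy : y ∈ M.Y) (x : EuclideanSpace ℝ (Fin n)),
      (x, y) ∈ M.coordStateSpace ∧ φ = M.evalFun x ⟨y, hy⟩ := by
  constructor
  · rintro ⟨hy, Φ, hΦ, hφ⟩
    refine ⟨hy, WithLp.toLp 2 fun i => Φ (M.basis i.succ), ⟨hy, Φ, hΦ, fun i => rfl⟩, ?_⟩
    rw [← M.eq_evalFun_of_isFiberState hΦ fun i => rfl]
    exact hφ
  · rintro ⟨hy, x, hx, rfl⟩
    obtain ⟨_, h⟩ := M.mem_coordStateSpace_iff.1 hx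
    exact ⟨hy, _, M.isFiberState_evalFun h, rfl⟩

theorem evalFun_combo (y : M.Y) (x₁ x₂ : EuclideanSpace ℝ (Fin n)) {s t : ℝ} (hst : s + t = 1) :
    (M.evalFun (s • x₁ + t • x₂) y : A → ℝ) =
      s • (M.evalFun x₁ y : A → ℝ) + t • (M.evalFun x₂ y : A → ℝ) := by
  funext a
  simp only [evalFun_apply, Pi.add_apply, Pi.smul_apply, smul_eq_mul]
  exact affEval_combo _ _ _ hst

theorem partiallyConvex_coordStateSpace : PartiallyConvex M.coordStateSpace := by
  rintro y - x₁ h₁ x₂ h₂ s t hs ht hst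
  obtain ⟨hy, h₁⟩ := M.mem_coordStateSpace_iff.1 h₁
  obtain ⟨_, h₂⟩ := M.mem_coordStateSpace_iff.1 h₂
  refine M.mem_coordStateSpace_iff.2 ⟨hy, fun a ha => ?_⟩
  rw [affEval_combo _ _ _ hst]
  exact add_nonneg (mul_nonneg hs (h₁ a ha)) (mul_nonneg ht (h₂ a ha))

theorem partiallyConvex_stateSpace : PartiallyConvex M.stateSpace := by
  rintro y - φ₁ h₁ φ₂ h₂ s t hs ht hst
  obtain ⟨hy, x₁, k₁, rfl⟩ := M.mem_stateSpace_iff.1 h₁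
  obtain ⟨_, x₂, k₂, rfl⟩ := M.mem_stateSpace_iff.1 h₂
  refine M.mem_stateSpace_iff.2 ⟨hy, s • x₁ + t • x₂, ?_, (M.evalFun_combo _ _ _ hst).symm⟩
  exact M.partiallyConvex_coordStateSpace y ⟨x₁, k₁⟩ k₁ k₂ hs ht hst

theorem projY_stateSpace : projY M.coordStateSpace = projY M.stateSpace := by
  ext y
  constructor
  · rintro ⟨x, hx⟩
    exact ⟨_, M.mem_stateSpace_iff.2 ⟨hx.1, x, hx, rfl⟩⟩
  · rintro ⟨φ, hφ⟩
    obtain ⟨_, x, hx, _⟩ := M.mem_stateSpace_iff.1 hφ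
    exact ⟨x, hx⟩

/-- The coordinates of a functional. -/
noncomputable def coords (φ : A → ℝ) : EuclideanSpace ℝ (Fin n) :=
  WithLp.toLp 2 fun i => φ (M.basis i.succ)

theorem continuous_coords : Continuous M.coords := by
  unfold coords; fun_prop

theorem coords_evalFun (x : EuclideanSpace ℝ (Fin n)) (y : M.Y) :
    M.coords (M.evalFun x y) = x := by
  ext i
  exact M.evalFun_basis_succ x y i

theorem coords_mem {φ : A → ℝ} {y : EuclideanSpace ℝ (Fin m)} (h : (φ, y) ∈ M.stateSpace) :
    (M.coords φ, y) ∈ M.coordStateSpace := by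
  obtain ⟨_, x, hx, rfl⟩ := M.mem_stateSpace_iff.1 h
  rwa [M.coords_evalFun]

theorem evalFun_coords {φ : A → ℝ} {y : EuclideanSpace ℝ (Fin m)} (h : (φ, y) ∈ M.stateSpace) :
    (M.evalFun (M.coords φ) ⟨y, h.1⟩ : A → ℝ) = φ := by
  obtain ⟨_, x, hx, rfl⟩ := M.mem_stateSpace_iff.1 h
  rw [M.coords_evalFun]

theorem continuous_evalFun :
    Continuous fun p : EuclideanSpace ℝ (Fin n) × M.Y => (M.evalFun p.1 p.2 : A → ℝ) := by
  refine continuous_pi fun a => continuous_affEval.comp (Continuous.prodMk ?_ continuous_fst)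
  exact continuous_pi fun i => (M.coeff a i).continuous.comp continuous_snd

/-- The coordinate state space is isomorphic to the state space. -/
theorem partiallyConvexIso_coordStateSpace_stateSpace :
    PartiallyConvexIso M.coordStateSpace M.stateSpace := by
  let Θ : M.coordStateSpace ≃ₜ M.stateSpace :=
    { toFun := fun p => ⟨(M.evalFun p.1.1 ⟨p.1.2, p.2.1⟩, p.1.2),
        M.mem_stateSpace_iff.2 ⟨p.2.1, p.1.1, p.2, rfl⟩⟩
      invFun := fun q => ⟨(M.coords q.1.1, q.1.2), M.coords_mem q.2⟩
      left_inv := fun p => Subtype.ext (Prod.ext (M.coords_evalFun _ _) rfl)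
      right_inv := fun q => Subtype.ext (Prod.ext (M.evalFun_coords q.2) rfl)
      continuous_toFun := by
        refine Continuous.subtype_mk (Continuous.prodMk ?_ (by fun_prop)) _
        exact M.continuous_evalFun.comp (Continuous.prodMk (by fun_prop) (by fun_prop))
      continuous_invFun := by
        refine Continuous.subtype_mk (Continuous.prodMk ?_ (by fun_prop)) _
        exact M.continuous_coords.comp (by fun_prop) }
  let φ : projY M.coordStateSpace ≃ₜ projY M.stateSpace := Homeomorph.setCongr M.projY_stateSpace
  have hY : ∀ y : projY M.coordStateSpace, (y : EuclideanSpace ℝ (Fin m)) ∈ M.Y := fun y => by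
    obtain ⟨x, hx⟩ := y.2
    exact hx.1
  let θ : ∀ y : projY M.coordStateSpace,
      slice M.coordStateSpace (y : EuclideanSpace ℝ (Fin m)) ≃ₜ
        slice M.stateSpace (φ y : EuclideanSpace ℝ (Fin m)) := fun y =>
    { toFun := fun x => ⟨M.evalFun x ⟨y, hY y⟩, M.mem_stateSpace_iff.2 ⟨hY y, x, x.2, rfl⟩⟩
      invFun := fun q => ⟨M.coords q, M.coords_mem q.2⟩
      left_inv := fun x => Subtype.ext (M.coords_evalFun _ _)
      right_inv := fun q => Subtype.ext (M.evalFun_coords q.2)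
      continuous_toFun := by
        refine Continuous.subtype_mk ?_ _
        exact M.continuous_evalFun.comp (Continuous.prodMk continuous_subtype_val continuous_const)
      continuous_invFun := by
        refine Continuous.subtype_mk ?_ _
        exact M.continuous_coords.comp continuous_subtype_val }
  refine ⟨Θ, φ, θ, fun x y h => rfl, fun y x₁ x₂ x₃ s t _ _ hst hx => ?_⟩
  change (M.evalFun x₃ ⟨y, hY y⟩ : A → ℝ) = _
  rw [hx]
  exact M.evalFun_combo _ _ _ hst

end FreeOrderUnitModule

/-- Partially convex sets are isomorphic to themselves. -/
theorem PartiallyConvexIso.refl {V W : Type*} [AddCommGroup V] [Module ℝ V] [TopologicalSpace V]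
    [TopologicalSpace W] (K : Set (V × W)) : PartiallyConvexIso K K :=
  ⟨Homeomorph.refl _, Homeomorph.refl _, fun _ => Homeomorph.refl _, fun _ _ _ => rfl,
    fun _ _ _ _ _ _ _ _ _ hx => hx⟩

/-! ### The function representation of a free order unit module -/

namespace FreeOrderUnitModule

variable {n m : ℕ} {A : Type u} {X : Type v} [AddCommGroup A] [Module ℝ A] [TopologicalSpace X]
  (M : FreeOrderUnitModule n m A X)

/-- The cone of a fiber in coordinates. -/
noncomputable def cone (y : M.Y) : PointedCone ℝ (Fin (n + 1) → ℝ) := M.pos.map (M.coeffAt y)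

theorem coeffAt_mem_cone_iff {y : M.Y} {a : A} :
    M.coeffAt y a ∈ M.cone y ↔ M.toFiber y a ∈ M.fiberPos y := by
  rw [cone, PointedCone.mem_map, M.mem_fiberPos_iff]
  simp only [M.toFiber_eq_iff_coeffAt]

theorem mem_cone_iff {y : M.Y} {c : Fin (n + 1) → ℝ} :
    c ∈ M.cone y ↔ M.toFiber y (M.ofConst c) ∈ M.fiberPos y := by
  rw [← M.coeffAt_mem_cone_iff, coeffAt_ofConst]

theorem isAOUSpace_cone (y : M.Y) : IsAOUSpace (M.cone y) (Pi.single 0 1) where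
  salient c h₁ h₂ := by
    rw [← M.coeffAt_ofConst y c, M.coeffAt_mem_cone_iff] at h₁
    rw [← M.coeffAt_ofConst y c, ← map_neg, M.coeffAt_mem_cone_iff, map_neg] at h₂
    have := (M.fiber_isAOUSpace y).salient _ h₁ h₂
    rwa [M.toFiber_eq_zero_iff_coeffAt, coeffAt_ofConst] at this
  order_unit c := by
    obtain ⟨r, hr, h⟩ := (M.fiber_isAOUSpace y).order_unit (M.toFiber y (M.ofConst c))
    refine ⟨r, hr, ?_⟩
    rwa [← M.coeffAt_ofConst y c, ← M.coeffAt_unit y, ← map_smul, ← map_sub,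
      M.coeffAt_mem_cone_iff, map_sub, map_smul]
  archimedean c h := by
    rw [M.mem_cone_iff]
    refine (M.fiber_isAOUSpace y).archimedean _ fun r hr => ?_
    have := h r hr
    rwa [← M.coeffAt_ofConst y c, ← M.coeffAt_unit y, ← map_smul, ← map_add,
      M.coeffAt_mem_cone_iff, map_add, map_smul] at this

theorem slice_coordStateSpace (y : M.Y) :
    slice M.coordStateSpace (y : EuclideanSpace ℝ (Fin m)) = coneStates (M.cone y) := by
  ext x
  refine M.mem_coordStateSpace_iff.trans ?_
  simp only [Subtype.coe_prop, exists_true_left, coneStates, cone, PointedCone.mem_map]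
  constructor
  · rintro h _ ⟨a, ha, rfl⟩
    exact h a ha
  · exact fun h a ha => h _ ⟨a, ha, rfl⟩

theorem interior_slice_nonempty (y : M.Y) :
    (interior (slice M.coordStateSpace (y : EuclideanSpace ℝ (Fin m)))).Nonempty := by
  rw [M.slice_coordStateSpace]
  exact (M.isAOUSpace_cone y).interior_coneStates_nonempty

theorem convex_slice (y : M.Y) :
    Convex ℝ (slice M.coordStateSpace (y : EuclideanSpace ℝ (Fin m))) := by
  rw [M.slice_coordStateSpace]
  exact convex_coneStates

theorem mem_cone_iff_slice {y : M.Y} {c : Fin (n + 1) → ℝ} : c ∈ M.cone y ↔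
    ∀ x ∈ slice M.coordStateSpace (y : EuclideanSpace ℝ (Fin m)), 0 ≤ affEval c x := by
  rw [M.slice_coordStateSpace]
  exact (M.isAOUSpace_cone y).mem_iff_coneStates c

theorem projY_coordStateSpace : projY M.coordStateSpace = M.Y := by
  ext y
  constructor
  · rintro ⟨x, hx⟩
    exact hx.1
  · intro hy
    obtain ⟨x, hx⟩ := (M.interior_slice_nonempty ⟨y, hy⟩).mono interior_subset
    exact ⟨x, hx⟩

theorem mem_pos_iff_coordStateSpace {a : A} : a ∈ M.pos ↔
    ∀ (y : M.Y), ∀ x ∈ slice M.coordStateSpace (y : EuclideanSpace ℝ (Fin m)),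
      0 ≤ affEval (M.coeffAt y a) x := by
  rw [M.mem_pos_iff_fiber]
  refine forall_congr' fun y => ?_
  rw [← M.coeffAt_mem_cone_iff, M.mem_cone_iff_slice]

/-- Elements of a fiber lift to `A` with control of the norm. -/
theorem exists_lift_of_fiber_bound {y : M.Y} {a : A} {r : ℝ} (hr : 0 < r)
    (h₁ : r • M.toFiber y M.unit - M.toFiber y a ∈ M.fiberPos y)
    (h₂ : r • M.toFiber y M.unit + M.toFiber y a ∈ M.fiberPos y) :
    ∃ b : A, M.coeffAt y b = M.coeffAt y a ∧ ∀ t, |M.emb b t| ≤ 2 * r := by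
  obtain ⟨q, hq, hqe⟩ := M.mem_fiberPos_iff.1 h₁
  obtain ⟨p, hp, hpe⟩ := M.mem_fiberPos_iff.1 h₂
  rw [← map_smul, ← map_sub, M.toFiber_eq_iff_coeffAt] at hqe
  rw [← map_smul, ← map_add, M.toFiber_eq_iff_coeffAt] at hpe
  -- Positive lifts `p`, `q` of `r u + a` and `r u - a` need not add up to `2 r u`; the defect `j`
  -- vanishes only over `y`.
  set j := p + q - (2 * r) • M.unit with hj
  have hj0 : M.coeffAt y j = 0 := by
    rw [hj, map_sub, map_add, hpe, hqe, ← map_add, ← map_sub]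
    convert map_zero (M.coeffAt y) using 2
    module
  choose N hN hNb using fun i => M.exists_emb_bound (M.basis i)
  -- A base function that dominates `j` and vanishes at `y`.
  set h : C(M.Y, ℝ) := ∑ i, N i • M.absBase (M.coeff j i) with hh
  have hval : ∀ y', h y' = ∑ i, N i * |M.coeff j i y'| := fun y' => by
    simp [hh, OrderUnitModule.absBase]
  have hnn : ∀ y', 0 ≤ h y' := fun y' => by
    rw [hval]
    exact Finset.sum_nonneg fun i _ => mul_nonneg (hN i).le (abs_nonneg _)
  have hy : h y = 0 := by
    rw [hval]
    refine Finset.sum_eq_zero fun i _ => ?_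
    rw [← coeffAt_apply, hj0, Pi.zero_apply, abs_zero, mul_zero]
  have hjle : ∀ t, M.emb j t ≤ M.emb (M.incl h) t := fun t => by
    rw [← M.sum_coeff j, hh]
    simp only [map_sum, ContinuousMap.sum_apply]
    exact Finset.sum_le_sum fun i _ => (abs_le.1 (M.abs_emb_act_le (hNb i t) _)).2
  have hpos : ∀ y', 0 < r + h y' := fun y' => by linarith [hnn y']
  -- A cutoff with `g y = 1`, `0 ≤ g ≤ 1` and `g h ≤ r`. Since `0 ≤ p ≤ 2r + h`, it gives `0 ≤ g p ≤
  -- 3r`, so `g p - r u` lies between `-r` and `2r`.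
  let g : C(M.Y, ℝ) := ⟨fun y' => r / (r + h y'),
    continuous_const.div (continuous_const.add h.continuous) fun y' => (hpos y').ne'⟩
  have hg : ∀ y', g y' = r / (r + h y') := fun _ => rfl
  refine ⟨M.act g p - r • M.unit, ?_, fun t => ?_⟩
  · rw [map_sub, coeffAt_act, hg, hy, add_zero, div_self hr.ne', one_smul, hpe, ← map_sub,
      add_sub_cancel_left]
  · have hg0 : 0 ≤ M.emb (M.incl g) t :=
      M.emb_incl_nonneg (fun y' => div_nonneg hr.le (hpos y').le) t
    have hg1 : M.emb (M.incl g) t ≤ 1 := by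
      rw [← M.emb_incl_smul_one 1 t]
      refine M.emb_incl_mono (fun y' => ?_) t
      simpa [hg] using div_le_one_of_le₀ (by linarith [hnn y']) (hpos y').le
    have hgh : M.emb (M.incl g) t * M.emb (M.incl h) t ≤ r := by
      rw [← ContinuousMap.mul_apply, ← M.incl_mul, ← M.emb_incl_smul_one r t]
      refine M.emb_incl_mono (fun y' => ?_) t
      rw [ContinuousMap.mul_apply, hg, ContinuousMap.smul_apply, ContinuousMap.one_apply,
        smul_eq_mul, mul_one, div_mul_eq_mul_div, div_le_iff₀ (hpos y')]
      nlinarith [hnn y']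
    have hp0 := (M.mem_pos_iff_emb p).1 hp t
    have hq0 := (M.mem_pos_iff_emb q).1 hq t
    have hjt := hjle t
    rw [hj, map_sub, map_add, map_smul, M.emb_unit, ContinuousMap.sub_apply,
      ContinuousMap.add_apply, ContinuousMap.smul_apply, ContinuousMap.one_apply, smul_eq_mul,
      mul_one] at hjt
    have hple : M.emb p t ≤ 2 * r + M.emb (M.incl h) t := by linarith
    rw [map_sub, map_smul, M.emb_act, M.emb_unit, ContinuousMap.sub_apply,
      ContinuousMap.mul_apply, ContinuousMap.smul_apply, ContinuousMap.one_apply, smul_eq_mul,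
      mul_one, abs_le]
    have := mul_le_mul_of_nonneg_left hple hg0
    constructor <;> nlinarith [mul_nonneg hg0 hp0]

/-- The coefficients in a fiber are controlled by the fiber norm, uniformly over the base. -/
theorem exists_fiber_coeff_bound {ε : ℝ} (hε : 0 < ε) : ∃ δ : ℝ, 0 < δ ∧ ∀ (y : M.Y) (a : A),
    M.fiberNorm y (M.toFiber y a) ≤ δ → ∀ i, |M.coeffAt y a i| ≤ ε := by
  by_contra! hcon
  choose y a h i hi using fun k : ℕ => hcon (1 / ((k : ℝ) + 1)) (by positivity)
  have h' := fun k => ((M.fiber_isAOUSpace (y k)).orderNorm_le_iff (by positivity)).1 (h k)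
  -- Lifting with norm control turns smallness in varying fibers into norm convergence in `A`, where
  -- the coefficient homeomorphism applies.
  choose b hb hbnd using fun k : ℕ => M.exists_lift_of_fiber_bound
    (by positivity : (0 : ℝ) < 1 / ((k : ℝ) + 1)) (h' k).1 (h' k).2
  have hlim : Tendsto (fun k => orderNorm M.pos M.unit (b k)) atTop (𝓝 0) := by
    refine squeeze_zero (fun k => orderNorm_nonneg _ _ _) (fun k =>
      (M.isAOUSpace.orderNorm_le_iff (by positivity)).2 (M.abs_emb_le_iff.2 (hbnd k))) ?_
    simpa using (tendsto_one_div_add_atTop_nhds_zero_nat (𝕜 := ℝ)).const_mul 2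
  have hcoeff := (M.tendsto_iff_coeff (fun k => M.coeff (b k)) 0).1 (by
    simpa only [M.sum_coeff, Pi.zero_apply, M.act_zero_left, Finset.sum_const_zero, sub_zero]
      using hlim)
  obtain ⟨k, hk⟩ := (eventually_all.2 fun i =>
    (hcoeff i).eventually (gt_mem_nhds hε)).exists
  have hle : |M.coeff (b k) (i k) (y k) - 0| ≤
      ⨆ y : M.Y, |M.coeff (b k) (i k) y - (0 : Fin (n + 1) → C(M.Y, ℝ)) (i k) y| := by
    refine le_ciSup (f := fun y : M.Y => |M.coeff (b k) (i k) y - 0|) ?_ (y k)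
    exact (isCompact_range (by fun_prop)).bddAbove
  rw [sub_zero, ← coeffAt_apply, hb] at hle
  linarith [hk (i k), hi k]

/-- Supplies a radius, independent of the fiber, for the upper hemicontinuity of the truncated
cones. -/
theorem exists_norm_ofConst_bound : ∃ r : ℝ, 0 < r ∧ ∀ (y : M.Y) (c : Fin (n + 1) → ℝ), ‖c‖ ≤ 1 →
    M.fiberNorm y (M.toFiber y (M.ofConst c)) ≤ r := by
  choose N hN hNb using fun i => M.exists_emb_bound (M.basis i)
  have hpos : 0 < ∑ i, N i := Finset.sum_pos (fun i _ => hN i) Finset.univ_nonempty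
  refine ⟨∑ i, N i, hpos, fun y c hc => ((M.fiber_isAOUSpace y).orderNorm_le_iff hpos.le).2 ?_⟩
  have := M.abs_emb_le_iff (a := M.ofConst c) (N := ∑ i, N i) |>.2 fun t => by
    simp only [ofConst, map_sum, map_smul, ContinuousMap.sum_apply, ContinuousMap.smul_apply,
      smul_eq_mul]
    refine (Finset.abs_sum_le_sum_abs _ _).trans (Finset.sum_le_sum fun i _ => ?_)
    rw [abs_mul]
    have h₁ : |c i| ≤ 1 := (norm_le_pi_norm c i).trans hc
    nlinarith [hNb i t, abs_nonneg (c i), abs_nonneg (M.emb (M.basis i) t)]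
  rw [← map_smul, ← map_sub, ← map_add]
  exact ⟨M.toFiber_mem_fiberPos this.1, M.toFiber_mem_fiberPos this.2⟩

theorem tendsto_coeff_of_fiberTendsto {ys : ℕ → M.Y} {y₀ : M.Y} {c : ℕ → Fin (n + 1) → ℝ} {a : A}
    (hys : Tendsto ys atTop (𝓝 y₀))
    (h : Tendsto (fun k => M.fiberNorm (ys k)
      (M.toFiber (ys k) (M.ofConst (c k)) - M.toFiber (ys k) a)) atTop (𝓝 0)) :
    Tendsto c atTop (𝓝 (M.coeffAt y₀ a)) := by
  rw [tendsto_pi_nhds]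
  intro i
  have h₁ : Tendsto (fun k => c k i - M.coeff a i (ys k)) atTop (𝓝 0) := by
    rw [tendsto_zero_iff_abs_tendsto_zero]
    refine (tendsto_zero_iff_eventually_le fun k => abs_nonneg _).2 fun ε hε => ?_
    obtain ⟨δ, hδ, hb⟩ := M.exists_fiber_coeff_bound hε
    filter_upwards [h.eventually (gt_mem_nhds hδ)] with k hk
    rw [← map_sub] at hk
    have := hb _ _ hk.le i
    rwa [map_sub, coeffAt_ofConst] at this
  have h₂ : Tendsto (fun k => M.coeff a i (ys k)) atTop (𝓝 (M.coeff a i y₀)) :=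
    ((M.coeff a i).continuous.tendsto _).comp hys
  simpa [coeffAt_apply] using h₁.add h₂

/-- Interior points of a slice are interior points of the neighbouring slices. -/
theorem eventually_mem_interior_slice {ys : ℕ → M.Y} {y₀ : M.Y} (hys : Tendsto ys atTop (𝓝 y₀))
    {x : EuclideanSpace ℝ (Fin n)}
    (hx : x ∈ interior (slice M.coordStateSpace (y₀ : EuclideanSpace ℝ (Fin m)))) :
    ∀ᶠ k in atTop,
      x ∈ interior (slice M.coordStateSpace (ys k : EuclideanSpace ℝ (Fin m))) := by
  by_contra hcon
  obtain ⟨φ, hφ, hnot⟩ := extraction_of_frequently_atTop (not_eventually.1 hcon)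
  -- Where `x` is not interior, some normalized function vanishes at `x` and is nonnegative on the
  -- slice, so it belongs to the fiber cone.
  choose c hc1 hcx hcnn using fun k => exists_supporting_affEval (M.convex_slice (ys (φ k)))
    (M.interior_slice_nonempty _) (hnot k)
  obtain ⟨r, hr, hbound⟩ := M.exists_norm_ofConst_bound
  obtain ⟨κ, a₀, hκ, ha₀, -, hys', a, rfl, hlim⟩ := M.pos_uhc r hr y₀ (fun k => ys (φ k))
    (hys.comp hφ.tendsto_atTop)
    (fun k => M.toFiber (ys (φ k)) (M.ofConst (c k))) fun k =>
      ⟨M.mem_cone_iff.1 (M.mem_cone_iff_slice.2 (hcnn k)), hbound _ _ (hc1 k).le⟩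
  have hc := M.tendsto_coeff_of_fiberTendsto (c := fun k => c (κ k)) hys' hlim
  have hnorm : ‖M.coeffAt y₀ a‖ = 1 := by
    refine tendsto_nhds_unique hc.norm ?_
    simp only [hc1]
    exact tendsto_const_nhds
  have hzero : affEval (M.coeffAt y₀ a) x = 0 := by
    have : Tendsto (fun k => affEval (c (κ k)) x) atTop (𝓝 (affEval (M.coeffAt y₀ a) x)) :=
      (continuous_affEval.tendsto (M.coeffAt y₀ a, x)).comp (hc.prodMk_nhds tendsto_const_nhds)
    simp only [hcx] at this
    exact tendsto_nhds_unique this tendsto_const_nhds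
  have := eq_zero_of_nonneg_of_mem_interior hx
    (M.mem_cone_iff_slice.1 (M.coeffAt_mem_cone_iff.2 ha₀)) hzero.le
  rw [this, norm_zero] at hnorm
  exact zero_ne_one hnorm

/-- The order bounds `-N_i u ≤ e_i ≤ N_i u` confine the coordinates to a box, and positivity is a
closed condition over the compact base. -/
theorem isCompact_coordStateSpace : IsCompact M.coordStateSpace := by
  choose N hN h₁ h₂ using fun i : Fin n => M.isAOUSpace.exists_bound (M.basis i.succ)
  set B : Set (EuclideanSpace ℝ (Fin n)) :=
    WithLp.toLp 2 '' Set.univ.pi fun i => Set.Icc (-N i) (N i)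
  have hB : IsCompact B :=
    (isCompact_univ_pi fun i => isCompact_Icc).image (PiLp.continuous_toLp 2 _)
  set T : Set (EuclideanSpace ℝ (Fin n) × M.Y) :=
    {p | ∀ a ∈ M.pos, 0 ≤ M.evalFun p.1 p.2 a} with hT
  have hTcl : IsClosed T := by
    simp only [hT, Set.ofPred_forall]
    exact isClosed_iInter fun a => isClosed_iInter fun _ =>
      isClosed_le continuous_const ((continuous_apply a).comp M.continuous_evalFun)
  have hTB : T ⊆ B ×ˢ Set.univ := by
    rintro ⟨x, y⟩ hxy
    refine ⟨⟨fun i => x i, fun i _ => ?_, rfl⟩, trivial⟩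
    have e₁ := hxy _ (h₁ i)
    have e₂ := hxy _ (h₂ i)
    simp only [map_sub, map_add, map_smul, M.evalFun_basis_succ, evalFun_apply, coeffAt_unit,
      affEval_single_zero, smul_eq_mul, mul_one] at e₁ e₂
    constructor <;> linarith
  have hTc : IsCompact T := (hB.prod isCompact_univ).of_isClosed_subset hTcl hTB
  have himage : M.coordStateSpace = (fun p => (p.1, (p.2 : EuclideanSpace ℝ (Fin m)))) '' T := by
    ext ⟨x, y⟩
    rw [M.mem_coordStateSpace_iff]
    constructor
    · rintro ⟨hy, h⟩
      exact ⟨(x, ⟨y, hy⟩), h, rfl⟩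
    · rintro ⟨⟨x', y'⟩, h, e⟩
      cases e
      exact ⟨y'.2, h⟩
  rw [himage]
  exact hTc.image (by fun_prop)

theorem isRegularPartiallyConvex_coordStateSpace :
    IsRegularPartiallyConvex M.coordStateSpace where
  isClosed := M.isCompact_coordStateSpace.isClosed
  partiallyConvex := M.partiallyConvex_coordStateSpace
  interior_nonempty y hy := by
    rw [projY_coordStateSpace] at hy
    exact M.interior_slice_nonempty ⟨y, hy⟩
  lhc := by
    intro y hy ys hys hlim x hx
    rw [projY_coordStateSpace] at hy
    simp only [projY_coordStateSpace] at hys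
    have hev := M.eventually_mem_interior_slice (ys := fun k => ⟨ys k, hys k⟩) (y₀ := ⟨y, hy⟩)
      (tendsto_subtype_rng.2 hlim) hx
    choose w hw using fun k => M.interior_slice_nonempty ⟨ys k, hys k⟩
    classical
    -- The constant sequence `x` works for all but finitely many `k`; there an arbitrary interior
    -- point is the default.
    refine ⟨fun k => if x ∈ interior (slice M.coordStateSpace (ys k)) then x else w k,
      fun k => ?_, ?_⟩
    · by_cases h : x ∈ interior (slice M.coordStateSpace (ys k))
      · simp [h]
      · simpa [h] using hw k
    · refine tendsto_const_nhds.congr' ?_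
      filter_upwards [hev] with k hk
      exact (if_pos hk).symm

/-- The representation of elements of `A` as functions on the coordinate state space. -/
noncomputable def toCaff : A →ₗ[ℝ] Caff M.coordStateSpace where
  toFun a := ⟨⟨fun z => M.evalFun z.1.1 ⟨z.1.2, z.2.1⟩ a, by
      exact (continuous_apply a).comp (M.continuous_evalFun.comp
        (Continuous.prodMk (by fun_prop) (by fun_prop)))⟩, by
    rintro y x₁ x₂ x₃ s t - - hst hx
    have := congrFun (M.evalFun_combo ⟨y, x₁.2.1⟩ (x₁ : _) x₂ hst) a
    rw [← hx] at this
    exact this⟩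
  map_add' a b := by
    ext z; exact map_add (M.evalFun z.1.1 ⟨z.1.2, z.2.1⟩) a b
  map_smul' r a := by
    ext z; exact map_smul (M.evalFun z.1.1 ⟨z.1.2, z.2.1⟩) r a

theorem toCaff_apply (a : A) (z : M.coordStateSpace) :
    (M.toCaff a : C(M.coordStateSpace, ℝ)) z = affEval (M.coeffAt ⟨z.1.2, z.2.1⟩ a) z.1.1 := rfl

theorem toCaff_injective : Function.Injective M.toCaff := by
  rw [injective_iff_map_eq_zero]
  intro a ha
  have h : ∀ y, M.coeffAt y a = 0 := fun y => by
    refine eq_of_affEval_eq_on (M.interior_slice_nonempty y) fun x hx => ?_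
    have := M.toCaff_apply a ⟨(x, y), hx⟩
    rw [ha] at this
    rw [affEval_zero]
    exact this.symm
  rw [← M.sum_coeff a]
  refine Finset.sum_eq_zero fun i _ => ?_
  have : M.coeff a i = 0 := by
    ext y; exact congrFun (h y) i
  rw [this, M.act_zero_left]

theorem toCaff_surjective : Function.Surjective M.toCaff := by
  intro f
  obtain ⟨c, hc⟩ := exists_continuous_coeff M.isCompact_coordStateSpace
    M.isRegularPartiallyConvex_coordStateSpace f
  have hY : ∀ y : M.Y, (y : EuclideanSpace ℝ (Fin m)) ∈ projY M.coordStateSpace := fun y => by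
    rw [projY_coordStateSpace]; exact y.2
  -- The coefficients live on the projection of `K_A`, which equals `Y` only propositionally.
  let d : Fin (n + 1) → C(M.Y, ℝ) := fun i =>
    (c i).comp ⟨fun y => ⟨(y : EuclideanSpace ℝ (Fin m)), hY y⟩, by fun_prop⟩
  refine ⟨∑ i, M.act (d i) (M.basis i), ?_⟩
  ext z
  have hd : M.coeff (∑ i, M.act (d i) (M.basis i)) = d := M.coeff_eq rfl
  rw [toCaff_apply, hc]
  congr 1
  funext i
  rw [coeffAt_apply, hd]
  rfl

/-- A free order unit module is the space of continuous partially affine functions on its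
coordinate state space. -/
noncomputable def equivCaff : A ≃ₗ[ℝ] Caff M.coordStateSpace :=
  LinearEquiv.ofBijective M.toCaff ⟨M.toCaff_injective, M.toCaff_surjective⟩

theorem equivCaff_apply (a : A) (z : M.coordStateSpace) :
    (M.equivCaff a : C(M.coordStateSpace, ℝ)) z = affEval (M.coeffAt ⟨z.1.2, z.2.1⟩ a) z.1.1 := rfl

theorem mem_pos_iff_equivCaff (a : A) :
    a ∈ M.pos ↔ ∀ z, 0 ≤ (M.equivCaff a : C(M.coordStateSpace, ℝ)) z := by
  rw [M.mem_pos_iff_coordStateSpace]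
  constructor
  · rintro h ⟨⟨x, y⟩, hxy⟩
    exact h ⟨y, hxy.1⟩ x hxy
  · intro h y x hx
    exact h ⟨(x, y), hx⟩

end FreeOrderUnitModule

/-! ### The free order unit module of continuous partially affine functions -/

section CaffModule

variable {n m : ℕ} {K : Set (EuclideanSpace ℝ (Fin n) × EuclideanSpace ℝ (Fin m))}

/-- The cone of nonnegative continuous partially affine functions. -/
def caffPos (K : Set (EuclideanSpace ℝ (Fin n) × EuclideanSpace ℝ (Fin m))) :
    PointedCone ℝ (Caff K) where
  carrier := {f | ∀ z, 0 ≤ (f : C(K, ℝ)) z}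
  add_mem' hf hg z := add_nonneg (hf z) (hg z)
  zero_mem' _ := le_rfl
  smul_mem' r _ hf z := mul_nonneg r.2 (hf z)

/-- The partially affine function with coefficients `c`. -/
def ofCoeff (c : Fin (n + 1) → C(projY K, ℝ)) : Caff K :=
  ⟨⟨fun z => affEval (fun i => c i (toBase K z)) z.1.1,
    continuous_affEval.comp (g := fun p => affEval p.1 p.2)
      (f := fun z : K => ((fun i => c i (toBase K z) : Fin (n + 1) → ℝ), z.1.1))
      (by fun_prop)⟩, by
    intro y x₁ x₂ x₃ s t _ _ hst hx
    have := affEval_combo (fun i => c i ⟨y, x₁, x₁.2⟩) x₁ x₂ hst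
    rw [← hx] at this
    exact this⟩

theorem ofCoeff_apply (c : Fin (n + 1) → C(projY K, ℝ)) (z : K) :
    (ofCoeff c : C(K, ℝ)) z = affEval (fun i => c i (toBase K z)) z.1.1 := rfl

/-- Functions on the base as partially affine functions. -/
def baseIncl (K : Set (EuclideanSpace ℝ (Fin n) × EuclideanSpace ℝ (Fin m))) :
    C(projY K, ℝ) →ₗ[ℝ] Caff K where
  toFun g := ⟨g.comp (toBase K), by
    intro y x₁ x₂ x₃ s t _ _ hst _
    change g ⟨y, x₁, x₁.2⟩ = s * g ⟨y, x₁, x₁.2⟩ + t * g ⟨y, x₁, x₁.2⟩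
    rw [← add_mul, hst, one_mul]⟩
  map_add' _ _ := rfl
  map_smul' _ _ := rfl

theorem baseIncl_apply (g : C(projY K, ℝ)) (z : K) :
    (baseIncl K g : C(K, ℝ)) z = g (toBase K z) := rfl

/-- The partially affine functions with constant coefficients. -/
def constFn (K : Set (EuclideanSpace ℝ (Fin n) × EuclideanSpace ℝ (Fin m))) :
    (Fin (n + 1) → ℝ) →ₗ[ℝ] Caff K where
  toFun c := ofCoeff fun i => ContinuousMap.const _ (c i)
  map_add' c d := by ext z; exact affEval_add c d z.1.1
  map_smul' r c := by ext z; exact affEval_smul r c z.1.1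

theorem constFn_apply (c : Fin (n + 1) → ℝ) (z : K) :
    (constFn K c : C(K, ℝ)) z = affEval c z.1.1 := rfl

theorem exists_mul_mem_Caff (g : C(projY K, ℝ)) (a : Caff K) :
    ∃ b : Caff K, (b : C(K, ℝ)) = (baseIncl K g : C(K, ℝ)) * (a : C(K, ℝ)) := by
  refine ⟨⟨_, ?_⟩, rfl⟩
  intro y x₁ x₂ x₃ s t hs ht hst hx
  have h₁ := Caff.isAffineMap a y x₁ x₂ x₃ s t hs ht hst hx
  change g ⟨y, x₁, x₁.2⟩ * (a : C(K, ℝ)) _ =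
    s * (g ⟨y, x₁, x₁.2⟩ * (a : C(K, ℝ)) _) + t * (g ⟨y, x₁, x₁.2⟩ * (a : C(K, ℝ)) _)
  simp only [smul_eq_mul] at h₁
  rw [h₁]; ring

/-- A multiplier `z` must keep each `z * x_i` affine on the slices. This kills its coefficient of
`x_i`, so `z` depends on `y` alone. -/
theorem range_baseIncl (hK : IsCompact K) (hR : IsRegularPartiallyConvex K) :
    Set.range (baseIncl K) = multiplicativeDomain (Caff K).subtype := by
  ext z
  constructor
  · rintro ⟨g, rfl⟩ a
    exact exists_mul_mem_Caff g a
  · intro hz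
    obtain ⟨c, hc⟩ := exists_continuous_coeff hK hR z
    have hc0 : ∀ (i : Fin n) (y : projY K), c i.succ y = 0 := by
      intro i y
      obtain ⟨b, hb⟩ := hz (constFn K (Pi.single i.succ 1))
      obtain ⟨d, hd⟩ := exists_continuous_coeff hK hR b
      refine coeff_succ_eq_zero_of_mul_coord (c := fun i => c i y) (d := fun i => d i y)
        (hR.interior_nonempty y y.2) fun x hx => ?_
      have h₁ := hd (ofSlice hx)
      have h₂ : (b : C(K, ℝ)) (ofSlice hx) = (z : C(K, ℝ)) (ofSlice hx) *
        (constFn K (Pi.single i.succ 1) : C(K, ℝ)) (ofSlice hx) :=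
          congrArg (fun f : C(K, ℝ) => f (ofSlice hx)) hb
      rw [constFn_apply, affEval_single_succ, one_mul, h₁, hc] at h₂
      exact h₂.symm
    refine ⟨c 0, ?_⟩
    ext w
    rw [hc, baseIncl_apply, affEval]
    simp [hc0]

theorem isAOUSpace_caffPos (hK : IsCompact K) : IsAOUSpace (caffPos K) (baseIncl K 1) where
  salient f h₁ h₂ := by
    ext z
    have e₁ := h₁ z
    have e₂ : 0 ≤ -(f : C(K, ℝ)) z := h₂ z
    change (f : C(K, ℝ)) z = 0
    linarith
  order_unit f := by
    have : CompactSpace K := isCompact_iff_compactSpace.1 hK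
    refine ⟨‖(f : C(K, ℝ))‖ + 1, by positivity, fun z => ?_⟩
    change 0 ≤ (‖(f : C(K, ℝ))‖ + 1) * 1 - (f : C(K, ℝ)) z
    have := (le_abs_self _).trans ((f : C(K, ℝ)).norm_coe_le_norm z)
    linarith
  archimedean f h z := by
    refine le_of_forall_pos_le_add fun r hr => ?_
    have : 0 ≤ r * 1 + (f : C(K, ℝ)) z := h r hr z
    linarith

/-- The order unit module of continuous partially affine functions on `K`. -/
abbrev caffModule
    (hK : IsCompact K) (hR : IsRegularPartiallyConvex K) : OrderUnitModule m (Caff K) K where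
  pos := caffPos K
  unit := baseIncl K 1
  isAOUSpace := isAOUSpace_caffPos hK
  compactSpace := isCompact_iff_compactSpace.1 hK
  t2Space := inferInstance
  emb := (Caff K).subtype
  emb_unit := rfl
  mem_pos_iff_emb _ := Iff.rfl
  Y := projY K
  isCompact_Y := isCompact_projY hK
  incl := baseIncl K
  incl_injective f g h := by
    ext y
    obtain ⟨x, hx⟩ := y.2
    exact congrArg (fun f : Caff K => (f : C(K, ℝ)) (ofSlice (y := y) hx)) h
  range_incl := range_baseIncl hK hR
  incl_one := rfl
  incl_mul _ _ := rfl

theorem caffModule_act_apply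
    (hK : IsCompact K) (hR : IsRegularPartiallyConvex K) (g : C(projY K, ℝ)) (a : Caff K) (z : K) :
    ((caffModule hK hR).act g a : C(K, ℝ)) z = g (toBase K z) * (a : C(K, ℝ)) z :=
  congrArg (fun f : C(K, ℝ) => f z) ((caffModule hK hR).emb_act g a)

theorem caffModule_sum_act
    (hK : IsCompact K) (hR : IsRegularPartiallyConvex K) (c : Fin (n + 1) → C(projY K, ℝ)) :
    ∑ i, (caffModule hK hR).act (c i) (constFn K (Pi.single i 1)) = ofCoeff c := by
  ext z
  rw [Submodule.coe_sum, ContinuousMap.sum_apply, ofCoeff_apply, affEval_eq_sum]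
  exact Finset.sum_congr rfl fun i _ => caffModule_act_apply hK hR _ _ _

/-- The functions vanishing over `y` form a closed order ideal containing the generators of `J_y`.
Conversely, vanishing on a slice with interior kills all coefficients at `y`, and coefficients
vanishing at `y` act into `J_y`. -/
theorem caffModule_mem_fiberIdeal_iff
    (hK : IsCompact K) (hR : IsRegularPartiallyConvex K) {y : projY K} {f : Caff K} :
    f ∈ (caffModule hK hR).fiberIdeal y ↔ ∀ z : K, toBase K z = y → (f : C(K, ℝ)) z = 0 := by
  constructor
  · let J : Submodule ℝ (Caff K) :=
      { carrier := {f | ∀ z : K, toBase K z = y → (f : C(K, ℝ)) z = 0}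
        add_mem' := fun {f g} hf hg z hz => by
          change (f : C(K, ℝ)) z + (g : C(K, ℝ)) z = 0
          rw [hf z hz, hg z hz, add_zero]
        zero_mem' := fun _ _ => rfl
        smul_mem' := fun r f hf z hz => by
          change r * (f : C(K, ℝ)) z = 0
          rw [hf z hz, mul_zero] }
    have hle : (caffModule hK hR).fiberIdeal y ≤ J := by
      refine (caffModule hK hR).fiberIdeal_le ?_ ?_ ?_
      · intro p q hp hpq hq z hz
        have h₁ : 0 ≤ (q : C(K, ℝ)) z - (p : C(K, ℝ)) z := hpq z
        rw [hq z hz] at h₁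
        exact le_antisymm (by linarith) (hp z)
      · intro a ha z hz
        refine abs_eq_zero.1 (le_antisymm (le_of_forall_pos_le_add fun ε hε => ?_) (abs_nonneg _))
        obtain ⟨b, hb, hab⟩ := ha ε hε
        have h₁ : |(a : C(K, ℝ)) z - (b : C(K, ℝ)) z| ≤ ε :=
          (caffModule hK hR).abs_emb_le_iff.1
            (((caffModule hK hR).isAOUSpace.orderNorm_le_iff hε.le).1 hab.le) z
        rwa [hb z hz, sub_zero, ← zero_add ε] at h₁
      · intro g hg z hz
        change g (toBase K z) = 0
        rw [hz, hg]
    exact fun hf => hle hf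
  · intro hf
    obtain ⟨c, hc⟩ := exists_continuous_coeff hK hR f
    have hc0 : (fun i => c i y) = 0 :=
      eq_of_affEval_eq_on (hR.interior_nonempty y y.2) fun x hx => by
        have := hc (ofSlice hx)
        rw [hf _ rfl] at this
        rw [affEval_zero]
        exact this.symm
    have he : f = ofCoeff c := by
      ext z; exact hc z
    rw [he, ← caffModule_sum_act hK hR]
    exact Submodule.sum_mem _ fun i _ =>
      (caffModule hK hR).act_mem_fiberIdeal (congrFun hc0 i) _

theorem caffModule_toFiber_eq_zero_iff
    (hK : IsCompact K) (hR : IsRegularPartiallyConvex K) {y : projY K} {f : Caff K} :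
    (caffModule hK hR).toFiber y f = 0 ↔ ∀ z : K, toBase K z = y → (f : C(K, ℝ)) z = 0 :=
  (caffModule hK hR).toFiber_eq_zero_iff.trans (caffModule_mem_fiberIdeal_iff hK hR)

/-- The base correction gives a globally positive representative of the same class. -/
theorem caffModule_toFiber_mem_fiberPos_iff
    (hK : IsCompact K) (hR : IsRegularPartiallyConvex K) {y : projY K} {f : Caff K} :
    (caffModule hK hR).toFiber y f ∈ (caffModule hK hR).fiberPos y ↔
      ∀ z : K, toBase K z = y → 0 ≤ (f : C(K, ℝ)) z := by
  rw [(caffModule hK hR).mem_fiberPos_iff]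
  constructor
  · rintro ⟨p, hp, hpf⟩ z hz
    rw [← sub_eq_zero, ← map_sub, caffModule_toFiber_eq_zero_iff] at hpf
    have h₁ : (p : C(K, ℝ)) z - (f : C(K, ℝ)) z = 0 := hpf z hz
    have h₂ := hp z
    linarith
  · intro hf
    obtain ⟨h, hh, hfh⟩ := exists_base_correction hK hR f y hf
    refine ⟨f + baseIncl K h, hfh, ?_⟩
    rw [← sub_eq_zero, ← map_sub, caffModule_toFiber_eq_zero_iff, add_sub_cancel_left]
    intro z hz
    rw [baseIncl_apply, hz, hh]

theorem caffModule_fiber_isAOUSpace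
    (hK : IsCompact K) (hR : IsRegularPartiallyConvex K) (y : projY K) :
    IsAOUSpace ((caffModule hK hR).fiberPos y)
      ((caffModule hK hR).toFiber y (caffModule hK hR).unit) where
  salient b h₁ h₂ := by
    obtain ⟨f, rfl⟩ := (caffModule hK hR).toFiber_surjective y b
    rw [← map_neg, caffModule_toFiber_mem_fiberPos_iff] at h₂
    rw [caffModule_toFiber_mem_fiberPos_iff] at h₁
    rw [caffModule_toFiber_eq_zero_iff]
    intro z hz
    have e₁ := h₁ z hz
    have e₂ : 0 ≤ -(f : C(K, ℝ)) z := h₂ z hz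
    exact le_antisymm (by linarith) e₁
  order_unit b := by
    obtain ⟨f, rfl⟩ := (caffModule hK hR).toFiber_surjective y b
    obtain ⟨r, hr, h⟩ := (caffModule hK hR).isAOUSpace.order_unit f
    refine ⟨r, hr, ?_⟩
    rw [← map_smul, ← map_sub]
    exact (caffModule hK hR).toFiber_mem_fiberPos h
  archimedean b h := by
    obtain ⟨f, rfl⟩ := (caffModule hK hR).toFiber_surjective y b
    rw [caffModule_toFiber_mem_fiberPos_iff]
    intro z hz
    refine le_of_forall_pos_le_add fun r hr => ?_
    have h₁ := h r hr
    rw [← map_smul, ← map_add, caffModule_toFiber_mem_fiberPos_iff] at h₁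
    have h₂ : 0 ≤ r * 1 + (f : C(K, ℝ)) z := h₁ z hz
    linarith

theorem caffModule_fiberNorm_le_iff
    (hK : IsCompact K) (hR : IsRegularPartiallyConvex K)
    {y : projY K} {f : Caff K} {r : ℝ} (hr : 0 ≤ r) :
    (caffModule hK hR).fiberNorm y ((caffModule hK hR).toFiber y f) ≤ r ↔
      ∀ z : K, toBase K z = y → |(f : C(K, ℝ)) z| ≤ r := by
  rw [OrderUnitModule.fiberNorm,
    (caffModule_fiber_isAOUSpace hK hR y).orderNorm_le_iff hr, ← map_smul, ← map_sub, ← map_add,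
    caffModule_toFiber_mem_fiberPos_iff, caffModule_toFiber_mem_fiberPos_iff]
  have e₁ : ∀ z, ((r • (caffModule hK hR).unit - f : Caff K) : C(K, ℝ)) z
      = r * 1 - (f : C(K, ℝ)) z := fun _ => rfl
  have e₂ : ∀ z, ((r • (caffModule hK hR).unit + f : Caff K) : C(K, ℝ)) z
      = r * 1 + (f : C(K, ℝ)) z := fun _ => rfl
  simp only [e₁, e₂, abs_le]
  constructor
  · rintro ⟨h₁, h₂⟩ z hz
    constructor <;> linarith [h₁ z hz, h₂ z hz]
  · intro h
    constructor <;> intro z hz <;> linarith [(h z hz).1, (h z hz).2]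

theorem caffModule_toFiber_eq_constFn
    (hK : IsCompact K) (hR : IsRegularPartiallyConvex K) {y : projY K} {f : Caff K}
    {c : Fin (n + 1) → C(projY K, ℝ)}
    (hc : ∀ z : K, (f : C(K, ℝ)) z = affEval (fun i => c i (toBase K z)) z.1.1) :
    (caffModule hK hR).toFiber y f =
      (caffModule hK hR).toFiber y (constFn K fun i => c i y) := by
  rw [← sub_eq_zero, ← map_sub, caffModule_toFiber_eq_zero_iff]
  intro z hz
  change (f : C(K, ℝ)) z - affEval (fun i => c i y) z.1.1 = 0
  rw [hc, hz, sub_self]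

theorem caffModule_exists_constFn
    (hK : IsCompact K) (hR : IsRegularPartiallyConvex K)
    {y : projY K} (b : (caffModule hK hR).Fiber y) :
    ∃ c : Fin (n + 1) → ℝ, (caffModule hK hR).toFiber y (constFn K c) = b := by
  obtain ⟨f, rfl⟩ := (caffModule hK hR).toFiber_surjective y b
  obtain ⟨c, hc⟩ := exists_continuous_coeff hK hR f
  exact ⟨_, (caffModule_toFiber_eq_constFn hK hR hc).symm⟩

theorem caffModule_fiber_finrank
    (hK : IsCompact K) (hR : IsRegularPartiallyConvex K) (y : projY K) :
    Module.finrank ℝ ((caffModule hK hR).Fiber y) = n + 1 := by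
  have hbij : Function.Bijective ((caffModule hK hR).toFiber y ∘ₗ constFn K) := by
    refine ⟨(injective_iff_map_eq_zero _).2 fun c hc => ?_, caffModule_exists_constFn hK hR⟩
    rw [LinearMap.comp_apply, caffModule_toFiber_eq_zero_iff] at hc
    refine eq_of_affEval_eq_on (hR.interior_nonempty y y.2) fun x hx => ?_
    rw [affEval_zero]
    exact hc (ofSlice hx) rfl
  rw [← (LinearEquiv.ofBijective _ hbij).finrank_eq, Module.finrank_fin_fun]

theorem exists_affEval_bound (hK : IsCompact K) : ∃ L : ℝ, 0 < L ∧ ∀ (c : Fin (n + 1) → ℝ) (z : K),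
    |affEval c z.1.1| ≤ ‖c‖ * L := by
  have hcont : Continuous fun p : EuclideanSpace ℝ (Fin n) × EuclideanSpace ℝ (Fin m) =>
      1 + ∑ i, |p.1 i| := by fun_prop
  obtain ⟨L, hL⟩ := (hK.image hcont).bddAbove
  refine ⟨max L 1, by positivity, fun c z => (abs_affEval_le c z.1.1).trans ?_⟩
  exact mul_le_mul_of_nonneg_left ((hL ⟨z.1, z.2, rfl⟩).trans (le_max_left _ _)) (norm_nonneg _)

/-- Norm bounds confine the coefficient vectors to a fixed ball, so a subsequence converges;
positivity and the bound `r` pass to the limit slice by lower hemicontinuity. -/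
theorem caffModule_pos_uhc
    (hK : IsCompact K) (hR : IsRegularPartiallyConvex K)
    {r : ℝ} (hr : 0 < r) {y₀ : projY K} {ys : ℕ → projY K}
    (hys : Tendsto ys atTop (𝓝 y₀)) (as : ∀ k, (caffModule hK hR).Fiber (ys k))
    (has : ∀ k, as k ∈ (caffModule hK hR).fiberPos (ys k) ∧
      (caffModule hK hR).fiberNorm (ys k) (as k) ≤ r) :
    ∃ (κ : ℕ → ℕ) (a₀ : (caffModule hK hR).Fiber y₀), StrictMono κ ∧
      a₀ ∈ (caffModule hK hR).fiberPos y₀ ∧ (caffModule hK hR).fiberNorm y₀ a₀ ≤ r ∧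
      (caffModule hK hR).FiberTendsto (fun k => ys (κ k)) (fun k => as (κ k)) y₀ a₀ := by
  choose c hc using fun k => caffModule_exists_constFn hK hR (as k)
  obtain rfl : (fun k => (caffModule hK hR).toFiber (ys k) (constFn K (c k))) = as := funext hc
  simp only [caffModule_toFiber_mem_fiberPos_iff, caffModule_fiberNorm_le_iff hK hR hr.le,
    constFn_apply] at has
  obtain ⟨B, hB, hbound⟩ := exists_coeff_bound hK hR
  have hcB : ∀ k, c k ∈ Metric.closedBall (0 : Fin (n + 1) → ℝ) (B * r) := fun k => by
    rw [mem_closedBall_zero_iff]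
    exact hbound (ys k) (ys k).2 (c k) r fun x hx => (has k).2 (ofSlice hx) rfl
  obtain ⟨c₀, -, κ, hκ, hlim⟩ := (isCompact_closedBall _ _).tendsto_subseq hcB
  have hyκ : Tendsto (fun k => ys (κ k)) atTop (𝓝 y₀) := hys.comp hκ.tendsto_atTop
  have hlimit : ∀ T : Set ℝ, IsClosed T →
      (∀ k, ∀ z : K, toBase K z = ys k → affEval (c k) z.1.1 ∈ T) →
      ∀ z : K, toBase K z = y₀ → affEval c₀ z.1.1 ∈ T := by
    intro T hT hmem z hz
    refine mem_of_interior_subset (T := affEval c₀ ⁻¹' T) (hR.partiallyConvex y₀ y₀.2)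
      (hR.interior_nonempty y₀ y₀.2) (hT.preimage (continuous_affEval_right c₀)) (fun x hx => ?_)
      (mem_slice_of_toBase_eq hz)
    obtain ⟨xs, hxs, hxlim⟩ := hR.lhc y₀ y₀.2 (fun k => ys (κ k)) (fun k => (ys (κ k)).2)
      ((continuous_subtype_val.tendsto _).comp hyκ) x hx
    have : Tendsto (fun k => affEval (c (κ k)) (xs k)) atTop (𝓝 (affEval c₀ x)) :=
      (continuous_affEval.tendsto (c₀, x)).comp (hlim.prodMk_nhds hxlim)
    exact hT.mem_of_tendsto this (Eventually.of_forall fun k =>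
      hmem (κ k) (ofSlice (y := ys (κ k)) (interior_subset (hxs k))) rfl)
  obtain ⟨L, hL, hLb⟩ := exists_affEval_bound hK
  refine ⟨κ, (caffModule hK hR).toFiber y₀ (constFn K c₀), hκ, ?_, ?_, hyκ, constFn K c₀, rfl, ?_⟩
  · rw [caffModule_toFiber_mem_fiberPos_iff]
    exact hlimit (Set.Ici 0) isClosed_Ici fun k => (has k).1
  · rw [caffModule_fiberNorm_le_iff hK hR hr.le]
    exact hlimit {t | |t| ≤ r} (isClosed_le continuous_abs continuous_const) fun k => (has k).2
  · have hz : Tendsto (fun k => ‖c (κ k) - c₀‖ * L) atTop (𝓝 0) := by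
      have := (tendsto_iff_norm_sub_tendsto_zero.1 hlim).mul_const L
      rwa [zero_mul] at this
    refine squeeze_zero (fun k => orderNorm_nonneg _ _ _) (fun k => ?_) hz
    rw [← map_sub, ← map_sub, caffModule_fiberNorm_le_iff hK hR (by positivity)]
    exact fun z _ => hLb (c (κ k) - c₀) z

/-- The two norms are equivalent: `exists_coeff_bound` gives one inequality and boundedness of `K`
the other. -/
theorem caffModule_tendsto_iff
    (hK : IsCompact K) (hR : IsRegularPartiallyConvex K) (cs : ℕ → Fin (n + 1) → C(projY K, ℝ))
    (c : Fin (n + 1) → C(projY K, ℝ)) :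
    Tendsto (fun k => orderNorm (caffPos K) (baseIncl K 1) (ofCoeff (cs k) - ofCoeff c)) atTop
      (𝓝 0) ↔ ∀ i, Tendsto (fun k => ⨆ y, |cs k i y - c i y|) atTop (𝓝 0) := by
  have : CompactSpace (projY K) := isCompact_iff_compactSpace.1 (isCompact_projY hK)
  have hnorm : ∀ (k : ℕ) {r : ℝ}, 0 ≤ r →
      (orderNorm (caffPos K) (baseIncl K 1) (ofCoeff (cs k) - ofCoeff c) ≤ r ↔
        ∀ z : K, |affEval (fun i => cs k i (toBase K z) - c i (toBase K z)) z.1.1| ≤ r) := by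
    intro k r hr
    rw [(isAOUSpace_caffPos hK).orderNorm_le_iff hr]
    refine (caffModule hK hR).abs_emb_le_iff.trans (forall_congr' fun z => ?_)
    have := affEval_sub (fun i => cs k i (toBase K z)) (fun i => c i (toBase K z)) z.1.1
    change |affEval (fun i => cs k i (toBase K z)) z.1.1 -
      affEval (fun i => c i (toBase K z)) z.1.1| ≤ r ↔ _
    rw [← this]
    rfl
  rw [tendsto_zero_iff_eventually_le fun k => orderNorm_nonneg _ _ _]
  have hsup : ∀ i, Tendsto (fun k => ⨆ y, |cs k i y - c i y|) atTop (𝓝 0) ↔ _ := fun i =>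
    tendsto_zero_iff_eventually_le fun k => Real.iSup_nonneg fun y => abs_nonneg _
  simp only [hsup]
  constructor
  · obtain ⟨B, hB, hbound⟩ := exists_coeff_bound hK hR
    intro h i ε hε
    filter_upwards [h (ε / B) (by positivity)] with k hk
    refine Real.iSup_le (fun y => ?_) hε.le
    have h₁ := hbound y y.2 (fun i => cs k i y - c i y) (ε / B) fun x hx =>
      (hnorm k (by positivity)).1 hk (ofSlice (y := y) hx)
    rw [mul_div_cancel₀ _ hB.ne'] at h₁
    exact (norm_le_pi_norm (fun i => cs k i y - c i y) i).trans h₁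
  · obtain ⟨L, hL, hLb⟩ := exists_affEval_bound hK
    intro h ε hε
    filter_upwards [eventually_all.2 fun i => h i (ε / L) (by positivity)] with k hk
    rw [hnorm k hε.le]
    intro z
    refine (hLb _ z).trans ?_
    rw [← le_div_iff₀ hL, pi_norm_le_iff_of_nonneg (by positivity)]
    intro i
    refine (le_ciSup (f := fun y => |cs k i y - c i y|) ?_ (toBase K z)).trans (hk i)
    exact (isCompact_range (by fun_prop)).bddAbove

/-- The continuous partially affine functions on a compact regular partially convex set form a
free order unit module. -/
noncomputable def freeCaffModule
    (hK : IsCompact K) (hR : IsRegularPartiallyConvex K) : FreeOrderUnitModule n m (Caff K) K where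
  toOrderUnitModule := caffModule hK hR
  basis i := constFn K (Pi.single i 1)
  existsUnique_coeff f := by
    obtain ⟨c, hc⟩ := exists_continuous_coeff hK hR f
    refine ⟨c, ?_, fun d hd => ?_⟩
    · dsimp only
      rw [caffModule_sum_act]
      ext z; exact hc z
    · dsimp only at hd
      rw [caffModule_sum_act] at hd
      refine continuous_coeff_unique hR fun z => ?_
      rw [← hc, hd, ofCoeff_apply]
  unit_eq := by
    rw [OrderUnitModule.act_one]
    ext z
    exact (affEval_single_zero z.1.1 1).symm
  fiber_isAOUSpace := caffModule_fiber_isAOUSpace hK hR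
  fiber_finrank := caffModule_fiber_finrank hK hR
  mem_pos_iff_fiber f := by
    constructor
    · exact fun hf y => (caffModule hK hR).toFiber_mem_fiberPos hf
    · exact fun hf z => (caffModule_toFiber_mem_fiberPos_iff hK hR).1 (hf (toBase K z)) z rfl
  pos_lhc y₀ ys hys a₀ ha₀ := by
    -- A single positive lift, restricted to all fibers, is the required sequence.
    obtain ⟨p, hp, rfl⟩ := (caffModule hK hR).mem_fiberPos_iff.1 ha₀
    refine ⟨fun k => (caffModule hK hR).toFiber (ys k) p,
      fun k => (caffModule hK hR).toFiber_mem_fiberPos hp, hys, p, rfl, ?_⟩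
    refine squeeze_zero (fun k => orderNorm_nonneg _ _ _) (fun k => ?_) tendsto_const_nhds
    rw [← map_sub, caffModule_fiberNorm_le_iff hK hR le_rfl, sub_self]
    intro z _
    exact abs_zero.le
  pos_uhc r hr y₀ ys hys as has := caffModule_pos_uhc hK hR hr hys as has
  tendsto_iff_coeff cs c := by
    simp only [caffModule_sum_act]
    exact caffModule_tendsto_iff hK hR cs c

theorem freeCaffModule_apply
    (hK : IsCompact K) (hR : IsRegularPartiallyConvex K) (f : Caff K) (z : K) :
    (f : C(K, ℝ)) z =
      affEval ((freeCaffModule hK hR).coeffAt (toBase K z) f) z.1.1 := by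
  have h := (freeCaffModule hK hR).sum_coeff f
  have h' : ofCoeff ((freeCaffModule hK hR).coeff f) = f :=
    (caffModule_sum_act hK hR _).symm.trans h
  conv_lhs => rw [← h']
  rfl

/-- A point outside `K_y` is separated from it by an affine function nonnegative on `K_y`. The base
correction makes this function globally positive without changing its coefficients at `y`, so
evaluation at the point is not a state. -/
theorem freeCaffModule_coordStateSpace
    (hK : IsCompact K) (hR : IsRegularPartiallyConvex K)
    : (freeCaffModule hK hR).coordStateSpace = K := by
  ext ⟨x, y⟩
  rw [FreeOrderUnitModule.mem_coordStateSpace_iff]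
  constructor
  · rintro ⟨hy, h⟩
    by_contra hx
    obtain ⟨c, hcx, hc⟩ := exists_separating_affEval (hR.partiallyConvex y hy)
      (isClosed_slice hR y) hx
    obtain ⟨g, hg, hcg⟩ := exists_base_correction hK hR (constFn K c : Caff K) ⟨y, hy⟩
      fun z hz => hc _ (mem_slice_of_toBase_eq hz)
    have h₁ := h (constFn K c + baseIncl K g) hcg
    have h₂ : (freeCaffModule hK hR).coeffAt ⟨y, hy⟩ (constFn K c + baseIncl K g) = c :=
      eq_of_affEval_eq_on (hR.interior_nonempty y hy) fun x hx => by
        have := freeCaffModule_apply hK hR (constFn K c + baseIncl K g)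
          (ofSlice (y := ⟨y, hy⟩) hx)
        refine this.symm.trans ?_
        change affEval c x + g ⟨y, hy⟩ = _
        rw [hg, add_zero]
    rw [h₂] at h₁
    linarith
  · intro h
    refine ⟨⟨x, h⟩, fun a ha => ?_⟩
    have := ha ⟨(x, y), h⟩
    rwa [freeCaffModule_apply hK hR] at this

end CaffModule

end PartialDuality

open PartialDuality
theorem theorem1p1 (n m : ℕ) :
    (∀ K : Set (EuclideanSpace ℝ (Fin n) × EuclideanSpace ℝ (Fin m)),
      IsCompact K → IsRegularPartiallyConvex K →
      ∃ M : FreeOrderUnitModule n m (Caff K) K,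
        (∀ f : Caff K, f ∈ M.pos ↔ ∀ z : K, 0 ≤ (f : C(K, ℝ)) z) ∧
        (M.unit : C(K, ℝ)) = 1 ∧
        M.emb = (Caff K).subtype ∧
        M.Y = projY K ∧
        (∀ (g : C(M.Y, ℝ)) (z : K) (hz : z.1.2 ∈ M.Y),
          (M.incl g : C(K, ℝ)) z = g ⟨z.1.2, hz⟩) ∧
        PartiallyConvex M.stateSpace ∧
        PartiallyConvexIso K M.stateSpace ∧
        PartiallyConvexIso K M.coordStateSpace) ∧
    (∀ (A : Type u) (X : Type v) [AddCommGroup A] [Module ℝ A] [TopologicalSpace X]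
      (M : FreeOrderUnitModule n m A X),
      ∃ K : Set (EuclideanSpace ℝ (Fin n) × EuclideanSpace ℝ (Fin m)),
        K = M.coordStateSpace ∧ IsCompact K ∧ IsRegularPartiallyConvex K ∧ projY K = M.Y ∧
        ∃ F : A ≃ₗ[ℝ] Caff K,
          (∀ a : A, a ∈ M.pos ↔ ∀ z : K, 0 ≤ (F a : C(K, ℝ)) z) ∧
          (F M.unit : C(K, ℝ)) = 1 ∧
          ∀ (g : C(M.Y, ℝ)) (a : A) (z : K) (hz : z.1.2 ∈ M.Y),
            (F (M.act g a) : C(K, ℝ)) z = g ⟨z.1.2, hz⟩ * (F a : C(K, ℝ)) z) := by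
  refine ⟨fun K hK hR => ⟨freeCaffModule hK hR, fun f => Iff.rfl, rfl, rfl, rfl,
    fun g z hz => rfl, (freeCaffModule hK hR).partiallyConvex_stateSpace, ?_, ?_⟩,
    fun A X _ _ _ M => ⟨M.coordStateSpace, rfl, M.isCompact_coordStateSpace,
      M.isRegularPartiallyConvex_coordStateSpace, M.projY_coordStateSpace, M.equivCaff,
      M.mem_pos_iff_equivCaff, ?_, fun g a z hz => ?_⟩⟩
  · have h := (freeCaffModule hK hR).partiallyConvexIso_coordStateSpace_stateSpace
    rwa [freeCaffModule_coordStateSpace] at h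
  · rw [freeCaffModule_coordStateSpace]
    exact PartiallyConvexIso.refl K
  · ext z
    rw [M.equivCaff_apply, M.coeffAt_unit, affEval_single_zero, ContinuousMap.one_apply]
  · rw [M.equivCaff_apply, M.equivCaff_apply, M.coeffAt_act, affEval_smul]
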